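/- Let $\mathbf{S}$ be the category of simplicial sets. For simplicial sets $X, Z$ and maps $g,g':X\to Z$ write $g\simeq g'$ if there is a map $h:X\times\Delta^1\to Z$ restricting to $g$ on $X\times\{0\}$ and to $g'$ on $X\times\{1\}$. A map in $\mathbf{S}$ is a Kan fibration if it has the right lifting property with respect to all horn inclusions $\Lambda^p_k\to\Delta^p$ ($p>0$, $0\le k\le p$), and a simplicial set $Z$ is a Kan complex if the map from $Z$ to the terminal object is a Kan fibration. If $Z$ is a Kan complex, then $\simeq$ is an equivalence relation on $\mathrm{Hom}(X,Z)$, and $[X,Z]$ denotes the set $\mathrm{Hom}(X,Z)/{\simeq}$ of homotopy classes. **Theorem 1.1.** Define a map $f:X\to Y$ in $\mathbf{S}$ to be 1. a *fibration* if it is a Kan fibration; 2. a *weak equivalence* if the map $f^{\#}:[Y,Z]\to[X,Z]$, $[g]\mapsto[g\circ f]$, is bijective for every Kan complex $Z$; 3. a *cofibration* if it has the left lifting property with respect to every map that is both a fibration and a weak equivalence. With these choices $\mathbf{S}$ is a model category, in the following strong sense: - (MC1) $\mathbf{S}$ has all small limits and colimits. - (MC2) If $f$ and $g$ are composable maps and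 two of $f$, $g$, $gf$ are weak equivalences, then so is the third. - (MC3) Every retract of a weak equivalence, fibration or cofibration is again a weak equivalence, fibration or cofibration, respectively. - (MC4) Given a commutative square with left side $i:A\to B$ and right side $p:X\to Y$, a diagonal filler $B\to X$ making both triangles commute exists if either (i) $i$ is a cofibration and $p$ is both a fibration and a weak equivalence, or (ii) $i$ is both a cofibration and a weak equivalence and $p$ is a fibration. - (MC5) Every map $f$ has two factorizations, each functorial in $f$: (i) $f=qj$ with $j$ a cofibration and $q$ both a fibration and a weak equivalence; (ii) $f=pi$ with $i$ both a cofibration and a weak equivalence and $p$ a fibration. -/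

import Mathlib

universe u

open CategoryTheory MonoidalCategory Simplicial

namespace KanSSet

/-- Two maps of simplicial sets are homotopic if there is a map `h : X ⊗ Δ[1] ⟶ Y`
from the product of `X` with the interval which restricts to `f` on `X × {0}` and
to `g` on `X × {1}`. -/
def Homotopic {X Y : SSet.{u}} (f g : X ⟶ Y) : Prop :=
  Nonempty (SSet.Homotopy f g)

/-- Homotopies may be precomposed with a map of simplicial sets. -/
theorem Homotopic.precomp {X Y Z : SSet.{u}} (f : X ⟶ Y) {g g' : Y ⟶ Z}
    (H : Homotopic g g') : Homotopic (f ≫ g) (f ≫ g') := by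
  obtain ⟨h⟩ := H
  refine ⟨SSet.RelativeMorphism.Homotopy.mk (f ▷ Δ[1] ≫ h.h) ?_ ?_ ?_⟩
  · exact congrArg (fun t => f ≫ t) h.h₀
  · exact congrArg (fun t => f ≫ t) h.h₁
  · ext n ⟨⟨x, hx⟩, _⟩
    exact hx.elim

/-- The homotopy set `[X, Z]`: the quotient of the set of maps `X ⟶ Z` by the homotopy
relation. This is used for `Z` a Kan complex, where homotopy is an equivalence relation. -/
def HomotopySet (X Z : SSet.{u}) : Type u :=
  Quot (fun f g : X ⟶ Z => Homotopic f g)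

/-- The map `f^# : [Y, Z] → [X, Z]` induced by precomposition with `f : X ⟶ Y`. -/
def HomotopySet.precomp {X Y : SSet.{u}} (f : X ⟶ Y) (Z : SSet.{u}) :
    HomotopySet Y Z → HomotopySet X Z :=
  Quot.map (fun g => f ≫ g) (fun _ _ H => H.precomp f)

/-- Kan fibrations: maps with the right lifting property with respect to the horn
inclusions `Λ[p, k] ⟶ Δ[p]` for all `p > 0` and `0 ≤ k ≤ p`. -/
def kanFibrations : MorphismProperty SSet.{u} :=
  fun _ _ f => ∀ (n : ℕ) (k : Fin (n + 2)), HasLiftingProperty (SSet.horn.{u} (n + 1) k).ι f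

/-- Weak equivalences: maps `f : X ⟶ Y` such that `f^# : [Y, Z] → [X, Z]` is bijective for
every Kan complex `Z`. -/
def weakEqs : MorphismProperty SSet.{u} :=
  fun _ _ f => ∀ Z : SSet.{u}, SSet.KanComplex Z →
    Function.Bijective (HomotopySet.precomp f Z)

/-- Cofibrations: maps with the left lifting property with respect to every map which is
both a Kan fibration and a weak equivalence. -/
def cofs : MorphismProperty SSet.{u} :=
  (kanFibrations ⊓ weakEqs).llp

end KanSSet

/-!
The axioms of a model category are formal once the two lifting classes are identified: the maps that
are both Kan fibrations and weak equivalences are the maps with the right lifting property with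
respect to monomorphisms (`kanFibrations_inf_weakEqs`), and the maps that are both cofibrations and
weak equivalences are the anodyne extensions (`cofs_inf_weakEqs`). The lifting axioms are then
tautological and the factorizations come from the small object argument for the boundary inclusions
and the horn inclusions. The second identification follows from the first by the retract argument.

The heart of the proof is therefore that a Kan fibration `p : X ⟶ Y` that is a weak equivalence has
the right lifting property with respect to monomorphisms (`rlp_of_weakEqs`). Weak equivalences are
defined by mapping into Kan complexes. If `X` and `Y` are Kan complexes, this definition
yields a homotopy inverse of `p`, which homotopy lifting turns into a section of `p` and a
deformation over `Y`, and lifts can be constructed by hand (`rlp_of_weakEqs_of_kanComplex`).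

The general case is reduced to this one by Kan's functor `Ex^∞`, the colimit of the iterates of the
functor `Ex` right adjoint to subdivision. It is used through the following facts.

* `Ex` preserves pullbacks and Kan fibrations (`kanFibrations_Ex_map`), because the subdivision of a
  horn inclusion is anodyne (`anodyne_onSet_hornFaces`).
* Every horn in `Ex X` has a filler in `Ex (Ex X)` (`exists_horn_filler_toEx`), so that `Ex^∞ X` is
  a Kan complex.
* The last vertex map `X ⟶ Ex X` is an anodyne extension (`anodyneExtensions_toEx`), hence so is
  `X ⟶ Ex^∞ X`. The simplices of `Ex X` outside of `X` are matched in pairs, each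
  consisting of a simplex and one of its faces, and the pairs are added one after the other along
  horn inclusions. The matching uses a filtration of `Ex X` by the number of initial
  vertices of a simplex that are not replaced by the initial segments they span (`LevelLE`).

Consequently `Ex^∞` turns `p` into a Kan fibration and weak equivalence between Kan complexes, which
has the lifting property. Its fibers are obtained by applying `Ex^∞` to those of `p`, and these
are Kan complexes, so that they are contractible as well. Finally, a Kan fibration with contractible
fibers has the required lifting property (`rlp_of_fibers`).
-/

namespace KanSSet

open SSet CartesianMonoidalCategory Limits

variable {A B C D W X Y Z : SSet.{u}}


/-! ### Lifting properties and homotopies -/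

theorem kanFibrations_eq_rlp : kanFibrations.{u} = modelCategoryQuillen.J.rlp := by
  ext X Y p
  refine ⟨fun h A B i hi => ?_, fun h n k => h _ (modelCategoryQuillen.horn_ι_mem_J _ _)⟩
  simp only [modelCategoryQuillen.J, MorphismProperty.iSup_iff] at hi
  obtain ⟨n, ⟨k⟩⟩ := hi
  exact h n k

theorem llp_kanFibrations : kanFibrations.{u}.llp = anodyneExtensions := by
  rw [kanFibrations_eq_rlp]; rfl

theorem hasLiftingProperty_of_anodyne {i : A ⟶ B} (hi : anodyneExtensions i) {p : X ⟶ Y}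
    (hp : kanFibrations p) : HasLiftingProperty i p := by
  rw [← llp_kanFibrations] at hi
  exact hi _ hp

theorem exists_lift_of_anodyne {i : A ⟶ B} (hi : anodyneExtensions i) {p : X ⟶ Y}
    (hp : kanFibrations p) {f : A ⟶ X} {g : B ⟶ Y} (w : f ≫ p = i ≫ g) :
    ∃ l : B ⟶ X, i ≫ l = f ∧ l ≫ p = g := by
  have := hasLiftingProperty_of_anodyne hi hp
  have sq : CommSq f i p g := ⟨w⟩
  exact ⟨sq.lift, sq.fac_left, sq.fac_right⟩

open modelCategoryQuillen in
theorem kanComplex_iff : KanComplex Z ↔ kanFibrations (terminal.from Z) := by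
  rw [kanFibrations_eq_rlp]
  exact (HomotopicalAlgebra.isFibrant_iff Z).trans (fibration_iff _)

theorem kanFibrations_terminal (hZ : KanComplex Z) : kanFibrations (terminal.from Z) :=
  kanComplex_iff.1 hZ

theorem exists_extension_of_anodyne {i : A ⟶ B} (hi : anodyneExtensions i) (hZ : KanComplex Z)
    (f : A ⟶ Z) : ∃ l : B ⟶ Z, i ≫ l = f := by
  obtain ⟨l, hl, -⟩ := exists_lift_of_anodyne hi (kanFibrations_terminal hZ) (f := f)
    (g := terminal.from B) (by subsingleton)
  exact ⟨l, hl⟩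

/-- Lifting against the pushout-product of two monomorphisms, one of which is anodyne. -/
theorem exists_pushoutProduct_lift (i : A ⟶ B) (j : C ⟶ D) [Mono i] [Mono j]
    (h : anodyneExtensions i ∨ anodyneExtensions j) {p : X ⟶ Y} (hp : kanFibrations p)
    (K : A ⊗ D ⟶ X) (G : B ⊗ C ⟶ X) (H : B ⊗ D ⟶ Y)
    (hKG : A ◁ j ≫ K = i ▷ C ≫ G) (hK : K ≫ p = i ▷ D ≫ H) (hG : G ≫ p = B ◁ j ≫ H) :
    ∃ L : B ⊗ D ⟶ X, i ▷ D ≫ L = K ∧ B ◁ j ≫ L = G ∧ L ≫ p = H := by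
  let sq := Functor.PushoutObjObj.ofHasPushout (curriedTensor SSet.{u}) i j
  have hsq : anodyneExtensions sq.ι := by
    obtain h | h := h
    · exact anodyneExtensions_pushoutObjObjι' sq h
    · exact anodyneExtensions_pushoutObjObjι sq h
  have hl : sq.inl ≫ sq.ι = B ◁ j := sq.inl_ι
  have hr : sq.inr ≫ sq.ι = i ▷ D := sq.inr_ι
  obtain ⟨L, h₁, h₂⟩ := exists_lift_of_anodyne hsq hp
    (f := sq.isPushout.desc G K hKG.symm) (g := H) (by
      apply sq.isPushout.hom_ext
      · rw [IsPushout.inl_desc_assoc, hG, ← hl, Category.assoc]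
      · rw [IsPushout.inr_desc_assoc, hK, ← hr, Category.assoc])
  refine ⟨L, ?_, ?_, h₂⟩
  · rw [← hr, Category.assoc, h₁, IsPushout.inr_desc]
  · rw [← hl, Category.assoc, h₁, IsPushout.inl_desc]

/-- The inclusion of the endpoint `e` of the cylinder. -/
noncomputable def endpoint (e : Fin 2) (X : SSet.{u}) : X ⟶ X ⊗ Δ[1] :=
  lift (𝟙 X) (SSet.const (stdSimplex.obj₀Equiv.{u}.symm e))

theorem endpoint_zero : endpoint 0 X = ι₀ := rfl

theorem endpoint_one : endpoint 1 X = ι₁ := rfl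

theorem endpoint_naturality (e : Fin 2) (f : X ⟶ Y) : endpoint e X ≫ f ▷ Δ[1] = f ≫ endpoint e Y :=
  rfl

theorem endpoint_fst (e : Fin 2) : endpoint e X ≫ fst X Δ[1] = 𝟙 X := rfl

/-- The constant simplex at a vertex of `Δ[1]`. -/
noncomputable abbrev constSimplex (e : Fin 2) (n : SimplexCategoryᵒᵖ) : (Δ[1] : SSet.{u}).obj n :=
  Δ[1].map (n.unop.const _ 0).op (stdSimplex.obj₀Equiv.{u}.symm e)

theorem constSimplex_apply (e : Fin 2) (n : ℕ) (i : Fin (n + 1)) :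
    DFunLike.coe (F := Δ[1] _⦋n⦌) (constSimplex.{u} e (.op ⦋n⦌)) i = e := rfl

theorem eq_constSimplex {e : Fin 2} {n : ℕ} {t : (Δ[1] : SSet.{u}) _⦋n⦌} {j : Fin 2} (hj : j ≠ e)
    (h : j ∉ Set.range t) : t = constSimplex e (.op ⦋n⦌) := by
  have key : ∀ a b c : Fin 2, a ≠ b → c ≠ a → c = b := by decide
  exact SSet.stdSimplex.ext _ _ fun i => key j e (t i) hj fun h' => h ⟨i, h'⟩

theorem notMem_range_constSimplex {e j : Fin 2} (hj : j ≠ e) (n : ℕ) :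
    j ∉ Set.range (DFunLike.coe (F := Δ[1] _⦋n⦌) (constSimplex.{u} e (.op ⦋n⦌))) := by
  rintro ⟨i, hi⟩
  exact hj (hi.symm.trans (constSimplex_apply.{u} e n i))

theorem mem_horn_one_iff (e : Fin 2) {n : SimplexCategoryᵒᵖ} (t : (Δ[1] : SSet.{u}).obj n) :
    t ∈ (horn 1 e).obj n ↔ t = constSimplex e n := by
  obtain ⟨⟨n⟩⟩ := n
  rw [mem_horn_iff_notMem_range]
  constructor
  · rintro ⟨j, hj, h⟩
    exact eq_constSimplex hj h
  · rintro rfl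
    have key : ∀ a : Fin 2, a + 1 ≠ a := by decide
    exact ⟨e + 1, key e, notMem_range_constSimplex.{u} (key e) n⟩

theorem anodyneExtensions_endpoint (e : Fin 2) (X : SSet.{u}) :
    anodyneExtensions (endpoint e X) := by
  let r : X ⟶ X ⊗ (Λ[1, e] : SSet.{u}) := lift (𝟙 X) (SSet.const
    ⟨constSimplex e _, (mem_horn_one_iff e _).2 rfl⟩)
  have : IsIso r := by
    refine ⟨fst _ _, rfl, ?_⟩
    ext n ⟨x, t, ht⟩
    · rfl
    · refine Subtype.ext ?_
      exact ((mem_horn_one_iff e t).1 ht).symm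
  have h : endpoint e X = r ≫ X ◁ Λ[1, e].ι := rfl
  rw [h]
  exact anodyneExtensions.comp_mem _ _ (.of_isIso r)
    ((anodyneExtensions.horn_ι e).whiskerLeft X)

/-- Relative homotopy lifting: a homotopy in the base of a Kan fibration can be lifted, starting
at a prescribed end `e` and extending a given lift over a subobject. -/
theorem exists_homotopy_lift (e : Fin 2) (i : A ⟶ B) [Mono i] {p : X ⟶ Y} (hp : kanFibrations p)
    (K : A ⊗ Δ[1] ⟶ X) (g : B ⟶ X) (H : B ⊗ Δ[1] ⟶ Y)
    (hKg : endpoint e A ≫ K = i ≫ g) (hK : K ≫ p = i ▷ Δ[1] ≫ H)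
    (hg : g ≫ p = endpoint e B ≫ H) :
    ∃ L : B ⊗ Δ[1] ⟶ X, i ▷ Δ[1] ≫ L = K ∧ endpoint e B ≫ L = g ∧ L ≫ p = H := by
  have key (V : SSet.{u}) : V ◁ Λ[1, e].ι = fst _ _ ≫ endpoint e V := by
    ext n ⟨x, t, ht⟩
    · rfl
    · exact (mem_horn_one_iff e t).1 ht
  obtain ⟨L, h₁, h₂, h₃⟩ := exists_pushoutProduct_lift i Λ[1, e].ι
    (.inr (anodyneExtensions.horn_ι e)) hp K (fst _ _ ≫ g) H
    (by rw [key, Category.assoc, hKg, whiskerRight_fst_assoc]) hK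
    (by rw [key, Category.assoc, Category.assoc, hg])
  refine ⟨L, h₁, ?_, h₃⟩
  let r : B ⟶ B ⊗ (Λ[1, e] : SSet.{u}) := lift (𝟙 B) (SSet.const
    ⟨constSimplex e _, (mem_horn_one_iff e _).2 rfl⟩)
  have h : endpoint e B = r ≫ B ◁ Λ[1, e].ι := rfl
  rw [h, Category.assoc, h₂]
  rfl

theorem mem_boundary_one_iff {n : SimplexCategoryᵒᵖ} (t : (Δ[1] : SSet.{u}).obj n) :
    t ∈ (boundary 1).obj n ↔ ∃ e, t = constSimplex e n := by
  have key : ∀ a : Fin 2, a + 1 ≠ a := by decide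
  obtain ⟨⟨n⟩⟩ := n
  rw [mem_boundary_iff_notMem_range]
  constructor
  · rintro ⟨j, h⟩
    exact ⟨j + 1, eq_constSimplex (key j).symm h⟩
  · rintro ⟨e, rfl⟩
    exact ⟨e + 1, notMem_range_constSimplex.{u} (key e) n⟩

/-- An end is determined by its constant simplices: simplices of `Δ[1]` are nonempty sequences. -/
theorem constSimplex_injective {e e' : Fin 2} {n : SimplexCategoryᵒᵖ}
    (h : constSimplex.{u} e n = constSimplex e' n) : e = e' := by
  obtain ⟨⟨n⟩⟩ := n
  exact DFunLike.congr_fun (F := Δ[1] _⦋n⦌) h 0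

/-- The inclusion of an end in `B ⊗ ∂Δ[1]`. -/
noncomputable def boundaryPoint (e : Fin 2) (B : SSet.{u}) : B ⟶ B ⊗ (∂Δ[1] : SSet.{u}) where
  app n := ↾fun b => (b, ⟨constSimplex e n, (mem_boundary_one_iff _).2 ⟨e, rfl⟩⟩)

theorem boundaryPoint_whiskerLeft (e : Fin 2) (B : SSet.{u}) :
    boundaryPoint e B ≫ B ◁ ∂Δ[1].ι = endpoint e B := rfl

theorem boundaryPoint_naturality (e : Fin 2) (f : A ⟶ B) :
    boundaryPoint e A ≫ f ▷ (∂Δ[1] : SSet.{u}) = f ≫ boundaryPoint e B := rfl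

theorem boundary_hom_ext {f g : B ⊗ (∂Δ[1] : SSet.{u}) ⟶ X}
    (h : ∀ e, boundaryPoint e B ≫ f = boundaryPoint e B ≫ g) : f = g := by
  ext n ⟨b, t, ht⟩
  obtain ⟨e, rfl⟩ := (mem_boundary_one_iff t).1 ht
  exact ConcreteCategory.congr_hom (congr_app (h e) n) b

/-- The end on which a simplex of `∂Δ[1]` is constant. -/
noncomputable def boundaryEnd {n : SimplexCategoryᵒᵖ} (t : (∂Δ[1] : SSet.{u}).obj n) : Fin 2 :=
  ((mem_boundary_one_iff _).1 t.2).choose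

theorem boundaryEnd_eq {n : SimplexCategoryᵒᵖ} {t : (∂Δ[1] : SSet.{u}).obj n} {e : Fin 2}
    (h : t.1 = constSimplex e n) : boundaryEnd t = e :=
  (constSimplex_injective (h.symm.trans ((mem_boundary_one_iff _).1 t.2).choose_spec)).symm

/-- The map from `B ⊗ ∂Δ[1]` given by a map on each of the two ends. -/
noncomputable def boundaryDesc (g : Fin 2 → (B ⟶ X)) : B ⊗ (∂Δ[1] : SSet.{u}) ⟶ X where
  app n := ↾fun z => (g (boundaryEnd z.2)).app n z.1
  naturality n m f := by
    ext ⟨b, t⟩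
    obtain ⟨e, h⟩ := (mem_boundary_one_iff t.1).1 t.2
    have h' : ((∂Δ[1] : SSet.{u}).map f t).1 = constSimplex e m :=
      congrArg (Δ[1].map f) h
    have hn : boundaryEnd t = e := boundaryEnd_eq h
    have hm : boundaryEnd ((∂Δ[1] : SSet.{u}).map f t) = e := boundaryEnd_eq h'
    change (g (boundaryEnd ((∂Δ[1] : SSet.{u}).map f t))).app m (B.map f b) =
      X.map f ((g (boundaryEnd t)).app n b)
    rw [hn, hm]
    exact NatTrans.naturality_apply (g e) f b

theorem boundaryPoint_desc (e : Fin 2) (g : Fin 2 → (B ⟶ X)) :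
    boundaryPoint e B ≫ boundaryDesc g = g e := by
  ext n x
  have key : boundaryEnd ((boundaryPoint e B).app n x).2 = e := boundaryEnd_eq rfl
  change (g (boundaryEnd ((boundaryPoint e B).app n x).2)).app n x = _
  rw [key]
  rfl

/-- A homotopy between the restrictions along an anodyne extension `i : A ⟶ B` of two maps on `B`
extends to a homotopy on `B`, relatively to a Kan fibration. -/
theorem exists_homotopy_extension (i : A ⟶ B) [Mono i] (hi : anodyneExtensions i)
    {p : X ⟶ Y} (hp : kanFibrations p)
    (K : A ⊗ Δ[1] ⟶ X) (g₀ g₁ : B ⟶ X) (H : B ⊗ Δ[1] ⟶ Y)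
    (hK₀ : ι₀ ≫ K = i ≫ g₀) (hK₁ : ι₁ ≫ K = i ≫ g₁) (hK : K ≫ p = i ▷ Δ[1] ≫ H)
    (hg₀ : g₀ ≫ p = ι₀ ≫ H) (hg₁ : g₁ ≫ p = ι₁ ≫ H) :
    ∃ L : B ⊗ Δ[1] ⟶ X, i ▷ Δ[1] ≫ L = K ∧ ι₀ ≫ L = g₀ ∧ ι₁ ≫ L = g₁ ∧ L ≫ p = H := by
  obtain ⟨L, h₁, h₂, h₃⟩ := exists_pushoutProduct_lift i ∂Δ[1].ι
    (.inl hi) hp K (boundaryDesc ![g₀, g₁]) H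
    (boundary_hom_ext fun e => by
      rw [← Category.assoc, boundaryPoint_whiskerLeft, ← Category.assoc, boundaryPoint_naturality,
        Category.assoc, boundaryPoint_desc]
      obtain rfl | rfl : e = 0 ∨ e = 1 := by omega
      · exact hK₀
      · exact hK₁) hK
    (boundary_hom_ext fun e => by
      rw [← Category.assoc, boundaryPoint_desc, ← Category.assoc, boundaryPoint_whiskerLeft]
      obtain rfl | rfl : e = 0 ∨ e = 1 := by omega
      · exact hg₀
      · exact hg₁)
  have h (e) : endpoint e B ≫ L = ![g₀, g₁] e := by
    rw [← boundaryPoint_whiskerLeft, Category.assoc, h₂, boundaryPoint_desc]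
  exact ⟨L, h₁, h 0, h 1, h₃⟩

/-- Two homotopies with the same start and the same projection along a Kan fibration have
endpoints which are homotopic over the base. -/
theorem exists_homotopy_of_common_start {p : X ⟶ Y} (hp : kanFibrations p)
    (H H' : W ⊗ Δ[1] ⟶ X) (h₀ : ι₀ ≫ H = ι₀ ≫ H') (h : H ≫ p = H' ≫ p) :
    ∃ K : W ⊗ Δ[1] ⟶ X, ι₀ ≫ K = ι₁ ≫ H ∧ ι₁ ≫ K = ι₁ ≫ H' ∧
      K ≫ p = fst _ _ ≫ ι₁ ≫ H ≫ p := by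
  have : Mono (ι₀ : W ⟶ W ⊗ Δ[1]) := mono_of_mono_fac (ι₀_fst W)
  have key (e : Fin 2) {V : SSet.{u}} (k : W ⟶ V) : endpoint e W ≫ fst _ _ ≫ k = k := by
    rw [← Category.assoc, endpoint_fst, Category.id_comp]
  obtain ⟨L, -, h₁, h₂, h₃⟩ := exists_homotopy_extension (ι₀ : W ⟶ W ⊗ Δ[1])
    (anodyneExtensions_endpoint 0 W) hp (fst _ _ ≫ ι₀ ≫ H) H H' (fst _ _ ≫ H ≫ p) (key 0 _)
    ((key 1 _).trans h₀)
    (by rw [whiskerRight_fst_assoc, Category.assoc, Category.assoc])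
    (by rw [← Category.assoc, ι₀_fst, Category.id_comp])
    (by rw [← Category.assoc, ι₁_fst, Category.id_comp, h])
  refine ⟨ι₁ ▷ Δ[1] ≫ L, ?_, ?_, ?_⟩
  · rw [← h₁, ← Category.assoc, ι₀_comp, Category.assoc]
  · rw [← h₂, ← Category.assoc, ι₁_comp, Category.assoc]
  · rw [Category.assoc, h₃, whiskerRight_fst_assoc]

/-! ### Homotopy classes -/

theorem homotopic_of_map {f g : X ⟶ Y} (H : X ⊗ Δ[1] ⟶ Y) (h₀ : ι₀ ≫ H = f) (h₁ : ι₁ ≫ H = g) :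
    Homotopic f g :=
  ⟨RelativeMorphism.Homotopy.mk H h₀ h₁ (by ext n ⟨⟨x, hx⟩, _⟩; exact hx.elim)⟩

theorem homotopic_iff {f g : X ⟶ Y} :
    Homotopic f g ↔ ∃ H : X ⊗ Δ[1] ⟶ Y, ι₀ ≫ H = f ∧ ι₁ ≫ H = g :=
  ⟨fun ⟨h⟩ => ⟨h.h, h.h₀, h.h₁⟩, fun ⟨H, h₀, h₁⟩ => homotopic_of_map H h₀ h₁⟩

theorem Homotopic.refl (f : X ⟶ Y) : Homotopic f f :=
  homotopic_of_map (fst _ _ ≫ f) rfl rfl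

theorem Homotopic.postcomp {f g : X ⟶ Y} (H : Homotopic f g) (k : Y ⟶ Z) :
    Homotopic (f ≫ k) (g ≫ k) := by
  obtain ⟨h, rfl, rfl⟩ := homotopic_iff.1 H
  exact homotopic_of_map (h ≫ k) (Category.assoc ..).symm (Category.assoc ..).symm

/-- For maps into a Kan complex, two homotopies with the same start can be compared: this single
property, together with reflexivity, gives symmetry and transitivity. -/
theorem Homotopic.euclidean (hY : KanComplex Y) {f g h : X ⟶ Y} (H : Homotopic f g)
    (H' : Homotopic f h) : Homotopic g h := by
  obtain ⟨H, h₀, h₁⟩ := homotopic_iff.1 H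
  obtain ⟨H', h₀', h₁'⟩ := homotopic_iff.1 H'
  obtain ⟨K, hK₀, hK₁, -⟩ := exists_homotopy_of_common_start (kanFibrations_terminal hY) H H'
    (h₀.trans h₀'.symm) (by subsingleton)
  exact homotopic_of_map K (hK₀.trans h₁) (hK₁.trans h₁')

theorem Homotopic.symm (hY : KanComplex Y) {f g : X ⟶ Y} (H : Homotopic f g) : Homotopic g f :=
  H.euclidean hY (.refl f)

theorem Homotopic.trans (hY : KanComplex Y) {f g h : X ⟶ Y} (H : Homotopic f g)
    (H' : Homotopic g h) : Homotopic f h :=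
  (H.symm hY).euclidean hY H'

theorem HomotopySet.mk_eq_iff (hY : KanComplex Y) {f g : X ⟶ Y} :
    (Quot.mk _ f : HomotopySet X Y) = Quot.mk _ g ↔ Homotopic f g :=
  Quot.eq.trans (Equivalence.eqvGen_iff ⟨.refl, .symm hY, .trans hY⟩)

theorem weakEqs_iff {f : X ⟶ Y} : weakEqs f ↔ ∀ Z : SSet.{u}, KanComplex Z →
    (∀ g : X ⟶ Z, ∃ g' : Y ⟶ Z, Homotopic (f ≫ g') g) ∧
    (∀ g g' : Y ⟶ Z, Homotopic (f ≫ g) (f ≫ g') → Homotopic g g') := by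
  refine forall₂_congr fun Z hZ => ?_
  rw [Function.Bijective, and_comm]
  refine and_congr ⟨fun h g => ?_, fun h => ?_⟩ ⟨fun h g g' H => ?_, fun h => ?_⟩
  · obtain ⟨⟨g'⟩, hg'⟩ := h (Quot.mk _ g)
    exact ⟨g', (HomotopySet.mk_eq_iff hZ).1 hg'⟩
  · intro g
    obtain ⟨g, rfl⟩ := Quot.exists_rep g
    obtain ⟨g', hg'⟩ := h g
    exact ⟨Quot.mk _ g', (HomotopySet.mk_eq_iff hZ).2 hg'⟩
  · exact (HomotopySet.mk_eq_iff hZ).1 (h ((HomotopySet.mk_eq_iff hZ).2 H))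
  · intro g g' H
    obtain ⟨g, rfl⟩ := Quot.exists_rep g
    obtain ⟨g', rfl⟩ := Quot.exists_rep g'
    exact (HomotopySet.mk_eq_iff hZ).2 (h g g' ((HomotopySet.mk_eq_iff hZ).1 H))

theorem HomotopySet.precomp_comp (f : X ⟶ Y) (g : Y ⟶ Z) (T : SSet.{u}) :
    HomotopySet.precomp (f ≫ g) T = HomotopySet.precomp f T ∘ HomotopySet.precomp g T := by
  funext h
  obtain ⟨h, rfl⟩ := Quot.exists_rep h
  exact congrArg (Quot.mk _) (Category.assoc f g h)

instance : weakEqs.{u}.HasTwoOutOfThreeProperty where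
  comp_mem f g hf hg T hT := by
    rw [HomotopySet.precomp_comp]
    exact (hf T hT).comp (hg T hT)
  of_postcomp f g hg hfg T hT := by
    have := hfg T hT
    rw [HomotopySet.precomp_comp] at this
    exact (Function.Bijective.of_comp_iff _ (hg T hT)).1 this
  of_precomp f g hf hfg T hT := by
    have := hfg T hT
    rw [HomotopySet.precomp_comp] at this
    exact (Function.Bijective.of_comp_iff' (hf T hT) _).1 this

instance : weakEqs.{u}.IsStableUnderRetracts where
  of_retract {X Y X' Y' f g} h hg := by
    rw [weakEqs_iff] at hg ⊢
    intro Z hZ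
    obtain ⟨h₁, h₂⟩ := hg Z hZ
    refine ⟨fun k => ?_, fun k k' H => ?_⟩
    · obtain ⟨k', hk'⟩ := h₁ (h.r.left ≫ k)
      refine ⟨h.i.right ≫ k', ?_⟩
      have := hk'.precomp h.i.left
      rwa [h.i_w_assoc, h.retract_left_assoc] at this
    · have := (h₂ (h.r.right ≫ k) (h.r.right ≫ k') (by
        rw [← h.r_w_assoc, ← h.r_w_assoc]
        exact H.precomp _)).precomp h.i.right
      rwa [h.retract_right_assoc, h.retract_right_assoc] at this

/-- Surjectivity on homotopy classes is extension of maps along `i`, injectivity is extension of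
homotopies. -/
theorem weakEqs_of_anodyne {i : A ⟶ B} [Mono i] (hi : anodyneExtensions i) : weakEqs i := by
  rw [weakEqs_iff]
  refine fun Z hZ => ⟨fun g => ?_, fun g g' H => ?_⟩
  · obtain ⟨l, hl⟩ := exists_extension_of_anodyne hi hZ g
    exact ⟨l, hl ▸ .refl _⟩
  · obtain ⟨H, h₀, h₁⟩ := homotopic_iff.1 H
    obtain ⟨L, -, h₀', h₁', -⟩ := exists_homotopy_extension i hi (kanFibrations_terminal hZ) H g g'
      (terminal.from _) h₀ h₁ (by subsingleton) (by subsingleton) (by subsingleton)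
    exact homotopic_of_map L h₀' h₁'

/-! ### Trivial fibrations -/

theorem exists_lift_of_rlp {p : X ⟶ Y} (hp : (MorphismProperty.monomorphisms SSet.{u}).rlp p)
    (i : A ⟶ B) [Mono i] {f : A ⟶ X} {g : B ⟶ Y} (w : f ≫ p = i ≫ g) :
    ∃ l : B ⟶ X, i ≫ l = f ∧ l ≫ p = g := by
  have := hp i (.infer_property i)
  have sq : CommSq f i p g := ⟨w⟩
  exact ⟨sq.lift, sq.fac_left, sq.fac_right⟩

theorem kanFibrations_of_rlp {p : X ⟶ Y}
    (hp : (MorphismProperty.monomorphisms SSet.{u}).rlp p) : kanFibrations p := by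
  rw [kanFibrations_eq_rlp]
  exact MorphismProperty.antitone_rlp modelCategoryQuillen.J_le_monomorphisms _ hp

theorem mono_whiskerLeft (W : SSet.{u}) (i : A ⟶ B) [Mono i] : Mono (W ◁ i) := by
  refine ⟨fun f g w => CartesianMonoidalCategory.hom_ext _ _ ?_ ?_⟩
  · simpa using congrArg (fun t => t ≫ fst _ _) w
  · rw [← cancel_mono i, Category.assoc, Category.assoc, ← whiskerLeft_snd, reassoc_of% w]

/-- A map with the right lifting property with respect to monomorphisms has a section `s`, and the
lifting property relative to the two ends of the cylinder gives a homotopy from `p ≫ s` to the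
identity. -/
theorem weakEqs_of_rlp {p : X ⟶ Y} (hp : (MorphismProperty.monomorphisms SSet.{u}).rlp p) :
    weakEqs p := by
  obtain ⟨s, -, hs⟩ := exists_lift_of_rlp hp (initial.to Y) (f := initial.to X) (g := 𝟙 Y)
    (by subsingleton)
  have := mono_whiskerLeft X ∂Δ[1].ι
  obtain ⟨L, h₁, -⟩ := exists_lift_of_rlp hp (X ◁ ∂Δ[1].ι) (f := boundaryDesc ![p ≫ s, 𝟙 X])
    (g := fst _ _ ≫ p) (boundary_hom_ext fun e => by
      rw [← Category.assoc, boundaryPoint_desc, ← Category.assoc, boundaryPoint_whiskerLeft,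
        ← Category.assoc, endpoint_fst, Category.id_comp]
      obtain rfl | rfl : e = 0 ∨ e = 1 := by omega
      · exact (Category.assoc ..).trans (by rw [hs, Category.comp_id])
      · exact Category.id_comp p)
  have h (e) : endpoint e X ≫ L = ![p ≫ s, 𝟙 X] e := by
    rw [← boundaryPoint_whiskerLeft, Category.assoc, h₁, boundaryPoint_desc]
  have H : Homotopic (p ≫ s) (𝟙 X) := homotopic_of_map L (h 0) (h 1)
  rw [weakEqs_iff]
  refine fun Z hZ => ⟨fun g => ⟨s ≫ g, ?_⟩, fun g g' H' => ?_⟩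
  · have := H.postcomp g
    rwa [Category.assoc, Category.id_comp] at this
  · have := H'.precomp s
    rwa [reassoc_of% hs, reassoc_of% hs] at this

/-- A Kan fibration `p` which has a section `s` such that `p ≫ s` is homotopic to the identity
is a trivial fibration: the homotopy may be chosen over the base. -/
theorem rlp_of_section {p : X ⟶ Y} (hp : kanFibrations p) {s : Y ⟶ X} (hs : s ≫ p = 𝟙 Y)
    (H : Homotopic (p ≫ s) (𝟙 X)) : (MorphismProperty.monomorphisms SSet.{u}).rlp p := by
  obtain ⟨H, h₀, h₁⟩ := homotopic_iff.1 H
  obtain ⟨K, hK₀, hK₁, hK⟩ := exists_homotopy_of_common_start hp (H ≫ p ≫ s) H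
    (by rw [reassoc_of% h₀, reassoc_of% hs, h₀])
    (by rw [Category.assoc, Category.assoc, hs, Category.comp_id])
  rw [reassoc_of% h₁] at hK₀
  rw [Category.assoc, Category.assoc, hs, reassoc_of% h₁, Category.comp_id] at hK
  intro A B i (_ : Mono i)
  refine ⟨fun {u v} sq => ?_⟩
  obtain ⟨L, hL₀, hL₁, hL⟩ := exists_homotopy_lift 0 i hp (u ▷ Δ[1] ≫ K) (v ≫ s) (fst _ _ ≫ v)
    (by rw [← Category.assoc, endpoint_naturality, Category.assoc, endpoint_zero, hK₀,
      reassoc_of% sq.w])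
    (by rw [Category.assoc, hK, whiskerRight_fst_assoc, whiskerRight_fst_assoc, sq.w])
    (by rw [Category.assoc, hs, Category.comp_id, ← Category.assoc, endpoint_fst,
      Category.id_comp])
  refine ⟨⟨ι₁ ≫ L, ?_, ?_⟩⟩
  · rw [← Category.assoc, ← ι₁_comp, Category.assoc, hL₀, ← Category.assoc, ι₁_comp,
      Category.assoc, hK₁, h₁, Category.comp_id]
  · rw [Category.assoc, hL, ← Category.assoc, ι₁_fst, Category.id_comp]

/-- Between Kan complexes, the definition of weak equivalences applied to the source and the target
of `p` provides a homotopy inverse. Homotopy lifting turns it into a strict section. -/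
theorem rlp_of_weakEqs_of_kanComplex {p : X ⟶ Y} (hp : kanFibrations p) (hX : KanComplex X)
    (hY : KanComplex Y) (hw : weakEqs p) : (MorphismProperty.monomorphisms SSet.{u}).rlp p := by
  rw [weakEqs_iff] at hw
  obtain ⟨s₀, hs₀⟩ := (hw X hX).1 (𝟙 X)
  have H : Homotopic (s₀ ≫ p) (𝟙 Y) := (hw Y hY).2 _ _ (by
    have := hs₀.postcomp p
    rwa [Category.assoc, Category.id_comp, ← Category.comp_id p, Category.assoc] at this)
  obtain ⟨G, hG₀, hG₁⟩ := homotopic_iff.1 H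
  obtain ⟨L, hL₀, hL⟩ := exists_lift_of_anodyne (anodyneExtensions_endpoint 0 Y) hp hG₀.symm
  refine rlp_of_section hp (s := ι₁ ≫ L) (by rw [Category.assoc, hL, hG₁]) ?_
  exact (((homotopic_of_map L hL₀ rfl).precomp p).symm hX).trans hX hs₀

/-! ### Kan fibrations with contractible fibers -/

/-- The contraction of a simplex onto its last vertex. -/
noncomputable def contraction (n : ℕ) : (Δ[n] ⊗ Δ[1] : SSet.{u}) ⟶ Δ[n] where
  app d := ↾fun z => stdSimplex.objMk
    { toFun i := if stdSimplex.asOrderHom z.2 i = 0 then stdSimplex.asOrderHom z.1 i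
        else Fin.last n
      monotone' i j h := by
        have h₁ := (stdSimplex.asOrderHom z.1).monotone h
        have h₂ := (stdSimplex.asOrderHom z.2).monotone h
        dsimp only
        split_ifs with hi hj hj
        · exact h₁
        · exact Fin.le_last _
        · exact absurd (Fin.le_zero_iff.1 (hj ▸ h₂)) hi
        · exact le_rfl }

theorem ι₀_contraction (n : ℕ) : ι₀ ≫ contraction.{u} n = 𝟙 _ := by
  ext ⟨⟨d⟩⟩ x i
  exact congrArg Fin.val (if_pos (c := (0 : Fin 2) = 0) (e := Fin.last n) rfl)

theorem ι₁_contraction (n : ℕ) :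
    ι₁ ≫ contraction.{u} n = SSet.const (stdSimplex.obj₀Equiv.{u}.symm (Fin.last n)) := rfl

/-- A Kan fibration with contractible fibers is a trivial fibration: a lifting problem over a
simplex is deformed, along the contraction onto the last vertex, to a lifting problem in a fiber,
and the solution is transported back by homotopy lifting. -/
theorem rlp_of_fibers {p : X ⟶ Y} (hp : kanFibrations p)
    (h : ∀ (y : Y _⦋0⦌) (m : ℕ) (f : (∂Δ[m] : SSet.{u}) ⟶ X), f ≫ p = SSet.const y →
      ∃ l : Δ[m] ⟶ X, ∂Δ[m].ι ≫ l = f ∧ l ≫ p = SSet.const y) :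
    (MorphismProperty.monomorphisms SSet.{u}).rlp p := by
  rw [rlp_monomorphisms]
  rintro _ _ _ ⟨n⟩
  refine ⟨fun {f v} sq => ?_⟩
  let H := contraction n ≫ v
  have hH₀ : ι₀ ≫ H = v := by rw [← Category.assoc, ι₀_contraction, Category.id_comp]
  have hH₁ : ι₁ ≫ H = SSet.const (v.app _ (stdSimplex.obj₀Equiv.{u}.symm (Fin.last n))) := by
    rw [← Category.assoc, ι₁_contraction, const_comp]
  obtain ⟨K, hK₀, hK⟩ := exists_lift_of_anodyne
    (anodyneExtensions_endpoint 0 (∂Δ[n] : SSet.{u})) hp (f := f) (g := ∂Δ[n].ι ▷ Δ[1] ≫ H) (by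
      rw [← Category.assoc, endpoint_naturality, Category.assoc, endpoint_zero, hH₀, sq.w])
  obtain ⟨l, hl, hl'⟩ := h (v.app _ (stdSimplex.obj₀Equiv.{u}.symm (Fin.last n))) n (ι₁ ≫ K) (by
    rw [Category.assoc, hK, ← Category.assoc, ι₁_comp, Category.assoc, hH₁, comp_const])
  obtain ⟨L, hL₁, -, hL⟩ := exists_homotopy_lift 1 ∂Δ[n].ι hp K l H hl.symm hK
    (by rw [hl', ← hH₁, endpoint_one])
  refine ⟨⟨ι₀ ≫ L, ?_, by rw [Category.assoc, hL, hH₀]⟩⟩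
  rw [← Category.assoc, ← ι₀_comp, Category.assoc, hL₁, ← endpoint_zero, hK₀]

/-! ### Nerves of preorders and the extension functor -/

/-- The nerve of a preorder in `Type`, as a simplicial set in an arbitrary universe: the
`n`-simplices are the monotone maps from `Fin (n + 1)`. -/
def orderNerve (α : Type) [Preorder α] : SSet.{u} where
  obj n := ULift.{u} (Fin (n.unop.len + 1) →o α)
  map f := ↾fun c => ⟨c.down.comp f.unop.toOrderHom⟩

section

variable {α β : Type} [Preorder α] [Preorder β]

/-- The map on nerves induced by a monotone map. -/
def orderNerve.map (f : α →o β) : orderNerve.{u} α ⟶ orderNerve β where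
  app _ := ↾fun c => ⟨f.comp c.down⟩

/-- The nerve of a subset, as a subcomplex. -/
def orderNerve.onSet (U : Set α) : (orderNerve.{u} α).Subcomplex where
  obj _ := {c | ∀ i, c.down i ∈ U}
  map _ _ hc _ := hc _

end

/-- The faces of the `n`-simplex, i.e. the nonempty subsets of `Fin (n + 1)`. -/
abbrev Faces (n : ℕ) : Type := {S : Finset (Fin (n + 1)) // S.Nonempty}

namespace Faces

variable {l m n : ℕ}

/-- The direct image of faces. -/
def map (f : Fin (m + 1) →o Fin (n + 1)) : Faces m →o Faces n where
  toFun S := ⟨S.1.image f, S.2.image f⟩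
  monotone' _ _ h := Finset.image_subset_image h

theorem mem_map {f : Fin (m + 1) →o Fin (n + 1)} {S : Faces m} {b : Fin (n + 1)} :
    b ∈ (map f S).1 ↔ ∃ a ∈ S.1, f a = b := Finset.mem_image

theorem map_id (n : ℕ) : map (OrderHom.id : Fin (n + 1) →o Fin (n + 1)) = OrderHom.id := by
  refine OrderHom.ext _ _ (funext fun S => Subtype.ext ?_)
  exact Finset.image_id

theorem map_comp (g : Fin (m + 1) →o Fin (n + 1)) (f : Fin (l + 1) →o Fin (m + 1)) :
    map (g.comp f) = (map g).comp (map f) := by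
  refine OrderHom.ext _ _ (funext fun S => Subtype.ext ?_)
  exact (Finset.image_image (f := f) (g := g) (s := S.1)).symm

/-- The largest vertex of a face. -/
def last (n : ℕ) : Faces n →o Fin (n + 1) where
  toFun S := S.1.max' S.2
  monotone' _ _ h := Finset.max'_subset _ h

theorem last_mem (S : Faces n) : last n S ∈ S.1 := Finset.max'_mem _ S.2

theorem le_last {S : Faces n} {a : Fin (n + 1)} (h : a ∈ S.1) : a ≤ last n S :=
  Finset.le_max' _ _ h

theorem last_eq {S : Faces n} {a : Fin (n + 1)} (h : a ∈ S.1) (h' : ∀ b ∈ S.1, b ≤ a) :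
    last n S = a :=
  le_antisymm (h' _ (last_mem S)) (le_last h)

theorem last_map (f : Fin (m + 1) →o Fin (n + 1)) (S : Faces m) :
    last n (map f S) = f (last m S) :=
  last_eq (mem_map.2 ⟨_, last_mem S, rfl⟩) fun b hb => by
    obtain ⟨a, ha, rfl⟩ := mem_map.1 hb
    exact f.monotone (le_last ha)

end Faces

/-- The subdivisions of the standard simplices. -/
def sdSimplex : SimplexCategory ⥤ SSet.{u} where
  obj n := orderNerve (Faces n.len)
  map f := orderNerve.map (Faces.map f.toOrderHom)
  map_id _ := congrArg orderNerve.map (Faces.map_id _)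
  map_comp f g := congrArg orderNerve.map (Faces.map_comp g.toOrderHom f.toOrderHom)

/-- Kan's extension functor: the `n`-simplices of `Ex.obj X` are the maps from the subdivision of
the `n`-simplex to `X`. -/
def Ex : SSet.{u} ⥤ SSet.{u} :=
  yoneda ⋙ (Functor.whiskeringLeft _ _ _).obj sdSimplex.op

instance : PreservesLimitsOfShape WalkingCospan Ex.{u} := by
  unfold Ex; infer_instance

/-- The sequence of last vertices of a chain of faces. -/
def lastVertices {m n : SimplexCategory} (c : Fin (m.len + 1) →o Faces n.len) : m ⟶ n :=
  SimplexCategory.Hom.mk ((Faces.last n.len).comp c)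

theorem lastVertices_map {l m n : SimplexCategory} (f : m ⟶ n)
    (c : Fin (l.len + 1) →o Faces m.len) :
    lastVertices ((Faces.map f.toOrderHom).comp c) = lastVertices c ≫ f := by
  ext i : 3
  exact Faces.last_map f.toOrderHom (c i)

/-- The last vertex map `X ⟶ Ex X`. -/
def toEx : 𝟭 SSet.{u} ⟶ Ex where
  app X :=
    { app n := ↾fun x =>
        { app m := ↾fun c => X.map (lastVertices (m := m.unop) (n := n.unop) c.down).op x
          naturality m m' f := by
            ext c
            exact ConcreteCategory.congr_hom
              (X.map_comp (lastVertices (m := m.unop) (n := n.unop) c.down).op f) x }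
      naturality n n' f := by
        ext x
        refine SSet.hom_ext fun m => ?_
        ext c
        refine (ConcreteCategory.congr_hom (X.map_comp f
          (lastVertices (m := m.unop) (n := n'.unop) c.down).op) x).symm.trans ?_
        refine congrArg (fun t : m.unop ⟶ n.unop => X.map t.op x) ?_
        exact (lastVertices_map f.unop c.down).symm }
  naturality X Y f := by
    ext n x
    refine SSet.hom_ext fun m => ?_
    ext c
    exact (NatTrans.naturality_apply f _ x).symm

instance (X : SSet.{u}) : Mono (toEx.app X) := by
  have (n : SimplexCategoryᵒᵖ) : Mono ((toEx.app X).app n) := by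
    rw [mono_iff_injective]
    intro x y h
    let c : (orderNerve.{u} (Faces n.unop.len)).obj n :=
      ⟨⟨fun i => ⟨Finset.Iic i, ⟨i, Finset.mem_Iic.2 le_rfl⟩⟩, fun i j hij a ha =>
        Finset.mem_Iic.2 ((Finset.mem_Iic.1 ha).trans hij)⟩⟩
    have hc : lastVertices (m := n.unop) (n := n.unop) c.down = 𝟙 _ := by
      ext i : 3
      exact Faces.last_eq (Finset.mem_Iic.2 le_rfl) fun b hb => Finset.mem_Iic.1 hb
    have key (z : X.obj n) :
        X.map (lastVertices (m := n.unop) (n := n.unop) c.down).op z = z := by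
      rw [hc, op_id, X.map_id]; rfl
    rw [← key x, ← key y]
    exact ConcreteCategory.congr_hom (congr_app h n) c
  exact NatTrans.mono_of_mono_app _

/-! ### Anodyne inclusions between nerves -/

theorem anodyne_homOfLE_trans {A₁ A₂ A₃ : X.Subcomplex} {h₁ : A₁ ≤ A₂} {h₂ : A₂ ≤ A₃}
    (H₁ : anodyneExtensions (Subcomplex.homOfLE h₁))
    (H₂ : anodyneExtensions (Subcomplex.homOfLE h₂)) :
    anodyneExtensions (Subcomplex.homOfLE (h₁.trans h₂)) :=
  anodyneExtensions.comp_mem _ _ H₁ H₂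

theorem anodyne_homOfLE_sup {A₁ A₂ A₃ A₄ : X.Subcomplex} (sq : Subcomplex.BicartSq A₁ A₂ A₃ A₄)
    (H : anodyneExtensions (Subcomplex.homOfLE sq.le₁₂)) :
    anodyneExtensions (Subcomplex.homOfLE sq.le₃₄) :=
  anodyneExtensions.of_isPushout sq.isPushout.flip H

open orderNerve in
/-- Inclusions of nerves which are deformation retracts, through a deformation that preserves
the subcomplex, are anodyne. -/
theorem anodyne_of_deformation {α : Type} [Preorder α] {U₁ U₂ V : Set α} (e e' : Fin 2)
    (φ : α → Fin 2 → α) (hV : ∀ v ∈ V, ∀ t, φ v t ∈ V) (h₁ : ∀ v ∈ U₁, ∀ t, φ v t ∈ U₁)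
    (h₂ : ∀ v ∈ U₂, ∀ t, φ v t ∈ U₂) (he : ∀ v ∈ V, φ v e ∈ U₁) (he' : ∀ v ∈ V, φ v e' = v)
    (hφ : ∀ v ∈ V, ∀ w ∈ V, v ≤ w → ∀ s t, s ≤ t → φ v s ≤ φ w t)
    (hle : onSet.{u} U₁ ⊔ onSet U₂ ≤ onSet V) :
    anodyneExtensions (Subcomplex.homOfLE hle) := by
  rw [← llp_kanFibrations]
  intro X Y p hp
  let H : (onSet.{u} V : SSet.{u}) ⊗ Δ[1] ⟶ onSet V :=
    { app n := ↾fun z => ⟨⟨⟨fun i => φ (z.1.1.down i) (stdSimplex.asOrderHom z.2 i),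
        fun i j hij => hφ _ (z.1.2 i) _ (z.1.2 j) (z.1.1.down.monotone hij) _ _
          ((stdSimplex.asOrderHom z.2).monotone hij)⟩⟩, fun i => hV _ (z.1.2 i) _⟩ }
  let H' : (onSet.{u} U₁ ⊔ onSet U₂ : (orderNerve.{u} α).Subcomplex).toFunctor ⊗ Δ[1] ⟶
      (onSet.{u} U₁ ⊔ onSet U₂ : (orderNerve.{u} α).Subcomplex).toFunctor :=
    { app n := ↾fun z => ⟨(H.app n (⟨z.1.1, hle n z.1.2⟩, z.2)).1, by
        obtain h | h := z.1.2
        · exact .inl fun i => h₁ _ (h i) _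
        · exact .inr fun i => h₂ _ (h i) _⟩ }
  let r : (onSet.{u} V : SSet.{u}) ⟶
      (onSet.{u} U₁ ⊔ onSet U₂ : (orderNerve.{u} α).Subcomplex).toFunctor :=
    { app n := ↾fun z => ⟨(H.app n (z, constSimplex e n)).1, .inl fun i => he _ (z.2 i)⟩ }
  have hH' : H' ≫ Subcomplex.homOfLE hle = Subcomplex.homOfLE hle ▷ Δ[1] ≫ H := rfl
  have hr : r ≫ Subcomplex.homOfLE hle = endpoint e _ ≫ H := rfl
  have hr' : endpoint e _ ≫ H' = Subcomplex.homOfLE hle ≫ r := rfl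
  have hH : endpoint e' _ ≫ H = 𝟙 _ := by
    ext n z
    refine Subtype.ext (ULift.ext _ _ ?_)
    ext i
    exact he' _ (z.2 i)
  have hHH : endpoint e' _ ≫ H' = 𝟙 _ := by
    rw [← cancel_mono (Subcomplex.homOfLE hle), Category.assoc, hH', ← Category.assoc,
      endpoint_naturality, Category.assoc, hH, Category.comp_id, Category.id_comp]
  refine ⟨fun {f g} sq => ?_⟩
  obtain ⟨L, hL₁, -, hL⟩ := exists_homotopy_lift e (Subcomplex.homOfLE hle) hp (H' ≫ f) (r ≫ f)
    (H ≫ g) (by rw [← Category.assoc, hr', Category.assoc])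
    (by rw [Category.assoc, sq.w, reassoc_of% hH'])
    (by rw [Category.assoc, sq.w, reassoc_of% hr])
  refine ⟨⟨endpoint e' _ ≫ L, ?_, ?_⟩⟩
  · rw [← Category.assoc, ← endpoint_naturality, Category.assoc, hL₁, ← Category.assoc, hHH,
      Category.id_comp]
  · rw [Category.assoc, hL, ← Category.assoc, hH, Category.id_comp]

/-! ### Subdivisions of horns -/

/-- The faces of the `k`-th horn of the `n`-simplex. -/
def hornFaces (n : ℕ) (k : Fin (n + 1)) : Set (Faces n) :=
  {S | ∃ j, j ≠ k ∧ j ∉ S.1}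

theorem mem_hornFaces_of_le {n : ℕ} {k : Fin (n + 1)} {S T : Faces n} (h : S ≤ T)
    (hT : T ∈ hornFaces n k) : S ∈ hornFaces n k :=
  hT.imp fun _ hj => ⟨hj.1, fun h' => hj.2 (h h')⟩

theorem mem_horn_iff' {n : ℕ} {k : Fin (n + 1)} {d : SimplexCategoryᵒᵖ}
    {t : (Δ[n] : SSet.{u}).obj d} :
    t ∈ (horn n k).obj d ↔ ∃ j, j ≠ k ∧ ∀ i, stdSimplex.asOrderHom t i ≠ j := by
  obtain ⟨⟨d⟩⟩ := d
  refine (mem_horn_iff_notMem_range t k).trans ?_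
  refine exists_congr fun j => ?_
  rw [exists_prop]
  exact and_congr_right fun _ => not_exists

section

variable (n : ℕ) (k : Fin (n + 1))

open orderNerve Finset

/-- Adding the vertex `k` to a face. -/
def addVertex (S : Faces n) : Faces n := ⟨insert k S.1, insert_nonempty _ _⟩

theorem le_addVertex (S : Faces n) : S ≤ addVertex n k S := fun _ h => mem_insert_of_mem h

theorem addVertex_mono {S T : Faces n} (h : S ≤ T) : addVertex n k S ≤ addVertex n k T :=
  insert_subset_insert k h

/-- The face consisting of the vertex `k`. -/
def vertexFace : Faces n := ⟨{k}, singleton_nonempty k⟩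

/-- The face consisting of all vertices. -/
def topFace : Faces n := ⟨univ, univ_nonempty⟩

theorem le_topFace (S : Faces n) : S ≤ topFace n := subset_univ _

theorem vertexFace_le {S : Faces n} (h : k ∈ S.1) : vertexFace n k ≤ S :=
  singleton_subset_iff.2 h

theorem topFace_notMem : topFace n ∉ hornFaces n k := fun ⟨j, _, hj⟩ => hj (mem_univ j)

theorem addVertex_mem {S : Faces n} (h : S ∈ hornFaces n k) : addVertex n k S ∈ hornFaces n k :=
  h.imp fun _ hj => ⟨hj.1, fun h' => hj.2 ((mem_insert.1 h').resolve_left hj.1)⟩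

theorem addVertex_eq_top {S : Faces n} (h : S ∉ hornFaces n k) : addVertex n k S = topFace n := by
  refine Subtype.ext (eq_univ_iff_forall.2 fun j => mem_insert.2 ?_)
  by_contra! hj
  exact h ⟨j, hj⟩

/-- The faces of the horn which contain the vertex `k`. -/
def hornStar : Set (Faces n) := {S | S ∈ hornFaces n k ∧ k ∈ S.1}

theorem onSet_mono {U V : Set (Faces n)} (h : U ⊆ V) : onSet.{u} U ≤ onSet V :=
  fun _ _ hc i => h (hc i)

theorem onSet_inf {α : Type} [Preorder α] (U V : Set α) :
    onSet.{u} U ⊓ onSet V = onSet (U ∩ V) := by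
  ext m c
  exact forall_and.symm

variable {n k} in
/-- A monotone self-map on `V` which is comparable to the identity gives a deformation. -/
theorem anodyne_of_le {U₁ U₂ V : Set (Faces n)} (r : Faces n → Faces n)
    (hU₁ : U₁ ⊆ V) (hU₂ : U₂ ⊆ V)
    (hr : ∀ v ∈ V, r v ∈ U₁) (h₂ : ∀ v ∈ U₂, r v ∈ U₂)
    (hmono : ∀ v ∈ V, ∀ w ∈ V, v ≤ w → r v ≤ r w)
    (hle : (∀ v ∈ V, v ≤ r v) ∨ (∀ v ∈ V, r v ≤ v)) :
    anodyneExtensions (Subcomplex.homOfLE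
      (sup_le (onSet_mono.{u} n hU₁) (onSet_mono n hU₂))) := by
  have key : ∀ t : Fin 2, t = 0 ∨ t = 1 := by decide
  have key' : ¬ (1 : Fin 2) ≤ 0 := by decide
  obtain hle | hle := hle
  · refine anodyne_of_deformation 1 0 (fun v t => if t = 0 then v else r v)
      ?_ ?_ ?_ (fun v hv => hr v hv) (fun v hv => rfl) ?_ _
    · intro v hv t
      obtain rfl | rfl := key t
      exacts [hv, hU₁ (hr v hv)]
    · intro v hv t
      obtain rfl | rfl := key t
      exacts [hv, hr v (hU₁ hv)]
    · intro v hv t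
      obtain rfl | rfl := key t
      exacts [hv, h₂ v hv]
    · intro v hv w hw hvw s t hst
      obtain rfl | rfl := key s <;> obtain rfl | rfl := key t
      exacts [hvw, hvw.trans (hle w hw), absurd hst key', hmono v hv w hw hvw]
  · refine anodyne_of_deformation 0 1 (fun v t => if t = 0 then r v else v)
      ?_ ?_ ?_ (fun v hv => hr v hv) (fun v hv => rfl) ?_ _
    · intro v hv t
      obtain rfl | rfl := key t
      exacts [hU₁ (hr v hv), hv]
    · intro v hv t
      obtain rfl | rfl := key t
      exacts [hr v (hU₁ hv), hv]
    · intro v hv t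
      obtain rfl | rfl := key t
      exacts [h₂ v hv, hv]
    · intro v hv w hw hvw s t hst
      obtain rfl | rfl := key s <;> obtain rfl | rfl := key t
      exacts [hmono v hv w hw hvw, (hle v hv).trans hvw, absurd hst key', hvw]

variable {n k} in
/-- The variant of `anodyne_of_le` with only one subset. -/
theorem anodyne_of_le' {U V : Set (Faces n)} (r : Faces n → Faces n)
    (hU : U ⊆ V) (hr : ∀ v ∈ V, r v ∈ U)
    (hmono : ∀ v ∈ V, ∀ w ∈ V, v ≤ w → r v ≤ r w)
    (hle : (∀ v ∈ V, v ≤ r v) ∨ (∀ v ∈ V, r v ≤ v)) :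
    anodyneExtensions (Subcomplex.homOfLE (onSet_mono.{u} n hU)) := by
  have h := anodyne_of_le.{u} (U₁ := U) (U₂ := U) r hU hU hr (fun v hv => hr v (hU hv)) hmono hle
  have H {A A' B : (orderNerve.{u} (Faces n)).Subcomplex} (hA : A ≤ B) (hA' : A' ≤ B)
      (e : A = A') (h : anodyneExtensions (Subcomplex.homOfLE hA)) :
      anodyneExtensions (Subcomplex.homOfLE hA') := by
    subst e; exact h
  exact H _ _ (sup_idem _) h

/-- The subdivision of a horn inclusion is anodyne. Two faces are not in the horn: the face opposite
to `k` and the face `T` of all vertices. The face `T` is first glued to the star of `k`, both being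
cones with apex `k`, then to the whole horn, which retracts onto the star through `addVertex`.
Finally the face opposite to `k` is pushed into `T`. -/
theorem anodyne_onSet_hornFaces (hn : vertexFace n k ∈ hornFaces n k) :
    anodyneExtensions (onSet.{u} (hornFaces n k)).ι := by
  let K := hornStar n k
  let T : Set (Faces n) := {topFace n}
  let v₀ : Set (Faces n) := {vertexFace n k}
  have hv₀ : vertexFace n k ∈ K := ⟨hn, mem_singleton_self k⟩
  have hle {S : Faces n} (hS : S ∈ K ∪ T) : vertexFace n k ≤ S := by
    obtain hS | rfl := hS
    · exact vertexFace_le n k hS.2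
    · exact le_topFace n _
  -- the edge from the vertex `k` to the barycenter is glued to the subdivision of the star
  have h₁ : anodyneExtensions (Subcomplex.homOfLE
      (le_sup_left : onSet.{u} K ≤ onSet K ⊔ onSet (v₀ ∪ T))) := by
    refine anodyne_homOfLE_sup (A₁ := onSet v₀) (A₂ := onSet (v₀ ∪ T)) ⟨sup_comm _ _, ?_⟩
      (anodyne_of_le' (fun _ => vertexFace n k) Set.subset_union_left (fun _ _ => rfl)
        (fun _ _ _ _ _ => le_rfl) (.inr ?_))
    · rw [onSet_inf]
      congr 1
      ext S
      constructor
      · rintro ⟨rfl | rfl, hS⟩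
        · rfl
        · exact (topFace_notMem n k hS.1).elim
      · rintro rfl
        exact ⟨.inl rfl, hv₀⟩
    · rintro v (rfl | rfl)
      · exact le_rfl
      · exact le_topFace n _
  have h₂ : anodyneExtensions (Subcomplex.homOfLE
      (sup_le (onSet_mono.{u} n (Set.subset_union_left))
        (onSet_mono n (Set.union_subset_union_left T (Set.singleton_subset_iff.2 hv₀))) :
        onSet.{u} K ⊔ onSet (v₀ ∪ T) ≤ onSet (K ∪ T))) := by
    refine anodyne_of_le (fun _ => vertexFace n k) Set.subset_union_left
      (Set.union_subset_union_left T (Set.singleton_subset_iff.2 hv₀)) (fun _ _ => hv₀)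
      (fun _ _ => .inl rfl)
      (fun _ _ _ _ _ => le_rfl) (.inr fun v hv => hle hv)
  have h₃ : anodyneExtensions (Subcomplex.homOfLE
      (onSet_mono.{u} n (Set.subset_union_left : K ⊆ K ∪ T))) := anodyne_homOfLE_trans h₁ h₂
  have h₄ : anodyneExtensions (Subcomplex.homOfLE
      (le_sup_right : onSet.{u} (hornFaces n k) ≤ onSet (K ∪ T) ⊔ onSet (hornFaces n k))) := by
    refine anodyne_homOfLE_sup (A₁ := onSet K) (A₂ := onSet (K ∪ T)) ⟨rfl, ?_⟩ h₃
    rw [onSet_inf]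
    congr 1
    ext S
    constructor
    · rintro ⟨hS | rfl, hS'⟩
      · exact hS
      · exact (topFace_notMem n k hS').elim
    · intro hS
      exact ⟨.inl hS, hS.1⟩
  have h₅ : anodyneExtensions (Subcomplex.homOfLE
      (sup_le (onSet_mono.{u} n (Set.union_subset_union_left T fun S hS => hS.1))
        (onSet_mono n Set.subset_union_left) :
        onSet.{u} (K ∪ T) ⊔ onSet (hornFaces n k) ≤ onSet (hornFaces n k ∪ T))) := by
    refine anodyne_of_le (addVertex n k) (Set.union_subset_union_left T fun S hS => hS.1)
      Set.subset_union_left ?_ (fun _ => addVertex_mem n k)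
      (fun _ _ _ _ => addVertex_mono n k) (.inl fun v _ => le_addVertex n k v)
    rintro v (hv | rfl)
    · exact .inl ⟨addVertex_mem n k hv, mem_insert_self _ _⟩
    · exact .inr (addVertex_eq_top n k (topFace_notMem n k))
  have h₆ : anodyneExtensions (Subcomplex.homOfLE
      (onSet_mono.{u} n (Set.subset_univ (hornFaces n k ∪ T)))) := by
    classical
    refine anodyne_of_le' (fun S => if S ∈ hornFaces n k then S else topFace n)
      (Set.subset_univ _) ?_ ?_
      (.inl fun v _ => ?_)
    · intro S _
      split_ifs with h
      exacts [.inl h, .inr rfl]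
    · intro S _ S' _ h
      split_ifs with h₁ h₂ h₂
      exacts [h, le_topFace n S, absurd (mem_hornFaces_of_le h h₂) h₁, le_rfl]
    · split_ifs
      exacts [le_rfl, le_topFace n v]
  have h₇ := anodyne_homOfLE_trans (anodyne_homOfLE_trans h₄ h₅) h₆
  have htop : onSet.{u} (Set.univ : Set (Faces n)) = ⊤ := by
    ext m c
    exact ⟨fun _ => trivial, fun _ _ => trivial⟩
  have : IsIso (onSet.{u} (Set.univ : Set (Faces n))).ι := by
    rw [htop]; infer_instance
  exact anodyneExtensions.comp_mem _ _ h₇ (.of_isIso (onSet.{u} Set.univ).ι)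

end

/-! ### Maps from horns to `Ex X` -/

namespace Faces

variable {n : ℕ}

/-- The monotone idempotent endomap with image a given face: it sends `a` to the largest vertex
of the face which is at most `a`, or to the smallest vertex of the face if there is none. -/
def retract (S : Faces n) : Fin (n + 1) →o Fin (n + 1) where
  toFun a := if h : (S.1.filter (· ≤ a)).Nonempty then (S.1.filter (· ≤ a)).max' h
    else S.1.min' S.2
  monotone' a b hab := by
    have hsub : S.1.filter (· ≤ a) ⊆ S.1.filter (· ≤ b) := fun x hx => by
      rw [Finset.mem_filter] at hx ⊢
      exact ⟨hx.1, hx.2.trans hab⟩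
    dsimp only
    split_ifs with h₁ h₂ h₂
    · exact Finset.max'_subset _ hsub
    · exact absurd (h₁.mono hsub) h₂
    · exact Finset.min'_le _ _ (Finset.mem_filter.1 (Finset.max'_mem _ h₂)).1
    · exact le_rfl

theorem retract_mem (S : Faces n) (a : Fin (n + 1)) : retract S a ∈ S.1 := by
  change dite _ _ _ ∈ _
  split_ifs with h
  · exact (Finset.mem_filter.1 (Finset.max'_mem _ h)).1
  · exact Finset.min'_mem _ _

theorem retract_eq {S : Faces n} {a : Fin (n + 1)} (h : a ∈ S.1) : retract S a = a := by
  have hne : (S.1.filter (· ≤ a)).Nonempty := ⟨a, Finset.mem_filter.2 ⟨h, le_rfl⟩⟩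
  change dite _ _ _ = _
  rw [dif_pos hne]
  exact le_antisymm (Finset.mem_filter.1 (Finset.max'_mem _ hne)).2
    (Finset.le_max' (S.1.filter (· ≤ a)) _ (Finset.mem_filter.2 ⟨h, le_rfl⟩))

theorem map_eq_map {m : ℕ} {f g : Fin (m + 1) →o Fin (n + 1)} {S : Faces m}
    (h : ∀ a ∈ S.1, f a = g a) : map f S = map g S :=
  Subtype.ext (Finset.image_congr h)

theorem map_retract_eq {S T : Faces n} (h : T ≤ S) : map (retract S) T = T :=
  (map_eq_map (g := OrderHom.id) fun _ ha => retract_eq (h ha)).trans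
    (congrArg (fun f => f T) (map_id n))

end Faces

section

variable {n : ℕ} {k : Fin (n + 1)}

open orderNerve

/-- The top of a chain of faces. -/
def topOfChain {d : SimplexCategoryᵒᵖ} (c : (orderNerve.{u} (Faces n)).obj d) : Faces n :=
  c.down (Fin.last _)

theorem le_topOfChain {d : SimplexCategoryᵒᵖ} (c : (orderNerve.{u} (Faces n)).obj d)
    (i : Fin (d.unop.len + 1)) : c.down i ≤ topOfChain c :=
  c.down.monotone (Fin.le_last i)

/-- The simplex of the horn given by the retraction onto a face. -/
def hornRetract (S : Faces n) (hS : S ∈ hornFaces n k) :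
    (Λ[n, k] : SSet.{u}).obj (.op ⦋n⦌) :=
  ⟨stdSimplex.objMk (m := .op ⦋n⦌) S.retract, mem_horn_iff'.2 (hS.imp fun _ hj =>
    ⟨hj.1, fun i h => hj.2 (h ▸ Faces.retract_mem S i)⟩)⟩

/-- The map on subdivisions induced by a simplex of `Δ[n]`. -/
def sdOf {d : SimplexCategoryᵒᵖ} (t : (Δ[n] : SSet.{u}).obj d) :
    sdSimplex.{u}.obj d.unop ⟶ orderNerve (Faces n) :=
  orderNerve.map (Faces.map (stdSimplex.asOrderHom t))

theorem sdOf_mem {d e : SimplexCategoryᵒᵖ} (t : (Λ[n, k] : SSet.{u}).obj d)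
    (c : (orderNerve.{u} (Faces d.unop.len)).obj e) :
    (sdOf t.1).app e c ∈ (onSet (hornFaces n k)).obj e := fun i => by
  obtain ⟨j, hj, h⟩ := mem_horn_iff'.1 t.2
  refine ⟨j, hj, fun h' => ?_⟩
  obtain ⟨a, -, ha⟩ := Faces.mem_map.1 h'
  exact h a ha

/-- The value of an `n`-simplex of `Ex X` on a chain of faces. -/
abbrev evalEx {d e : SimplexCategoryᵒᵖ} (x : (Ex.obj X).obj d)
    (c : (orderNerve.{u} (Faces d.unop.len)).obj e) : X.obj e :=
  NatTrans.app (F := sdSimplex.obj d.unop) (G := X) x e c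

variable (h : (Λ[n, k] : SSet.{u}) ⟶ Ex.obj X)

theorem evalEx_naturality {d d' e : SimplexCategoryᵒᵖ} (g : d ⟶ d')
    (t : (Λ[n, k] : SSet.{u}).obj d) (c : (orderNerve.{u} (Faces d'.unop.len)).obj e) :
    evalEx (h.app d' ((Λ[n, k] : SSet.{u}).map g t)) c =
      evalEx (h.app d t) ((sdSimplex.map g.unop).app e c) :=
  congrArg (fun x : (Ex.obj X).obj d' => evalEx x c) (NatTrans.naturality_apply h g t)

/-- The value of `h` at `t` on a chain of faces depends only on the restriction of `t` to the top of
the chain: precomposing with the retraction onto this top face does not change the chain. -/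
theorem evalEx_congr {d e : SimplexCategoryᵒᵖ} (t t' : (Λ[n, k] : SSet.{u}).obj d)
    (c : (orderNerve.{u} (Faces d.unop.len)).obj e)
    (hc : ∀ a ∈ (topOfChain c).1, stdSimplex.asOrderHom t.1 a = stdSimplex.asOrderHom t'.1 a) :
    evalEx (h.app d t) c = evalEx (h.app d t') c := by
  let g : d ⟶ d := Quiver.Hom.op (SimplexCategory.Hom.mk (topOfChain c).retract)
  have hg : (sdSimplex.{u}.map g.unop).app e c = c := by
    refine ULift.ext _ _ ?_
    ext i : 2
    exact Faces.map_retract_eq (le_topOfChain c i)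
  have htt' : (Λ[n, k] : SSet.{u}).map g t = (Λ[n, k] : SSet.{u}).map g t' := by
    refine Subtype.ext (stdSimplex.objEquiv.injective ?_)
    ext i : 3
    exact hc _ (Faces.retract_mem _ i)
  rw [← hg, ← evalEx_naturality h g t, ← evalEx_naturality h g t', htt']

/-- A map from a horn to `Ex X` corresponds to a map from the subdivision of the horn to `X`. A
chain of faces is evaluated on the simplex of the horn given by the retraction onto its top. -/
def sdDesc : (onSet.{u} (hornFaces n k) : SSet.{u}) ⟶ X where
  app e := ↾fun c => evalEx (h.app _ (hornRetract (topOfChain c.1) (c.2 _))) c.1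
  naturality e e' g := by
    ext c
    refine (evalEx_congr h _ (hornRetract (topOfChain c.1) (c.2 _)) _ fun a ha => ?_).trans
      (NatTrans.naturality_apply (F := sdSimplex.obj ⦋n⦌) (G := X) (h.app _
        (hornRetract (topOfChain c.1) (c.2 _))) g c.1)
    exact (Faces.retract_eq ha).trans (Faces.retract_eq (le_topOfChain c.1 _ ha)).symm

theorem evalEx_eq_sdDesc {d e : SimplexCategoryᵒᵖ} (t : (Λ[n, k] : SSet.{u}).obj d)
    (c : (orderNerve.{u} (Faces d.unop.len)).obj e) :
    evalEx (h.app d t) c = (sdDesc h).app e ⟨(sdOf t.1).app e c, sdOf_mem t c⟩ := by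
  let S : Faces n := topOfChain ((sdOf t.1).app e c)
  have hS : S ∈ hornFaces n k := sdOf_mem t c _
  let g : Opposite.op ⦋n⦌ ⟶ d :=
    Quiver.Hom.op (SimplexCategory.Hom.mk (stdSimplex.asOrderHom t.1))
  refine (evalEx_congr h t ((Λ[n, k] : SSet.{u}).map g (hornRetract S hS)) c
    fun a ha => ?_).trans (evalEx_naturality h g _ c)
  exact (Faces.retract_eq (Faces.mem_map.2 ⟨a, ha, rfl⟩)).symm

end

theorem vertexFace_mem_hornFaces (n : ℕ) (k : Fin (n + 2)) :
    vertexFace (n + 1) k ∈ hornFaces (n + 1) k := by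
  obtain ⟨j, hj⟩ := exists_ne k
  exact ⟨j, hj, fun h => hj (Finset.mem_singleton.1 h)⟩

theorem stdSimplex_hom_eq {n : ℕ} (y : (Δ[n] : SSet.{u}) ⟶ X) {d : SimplexCategoryᵒᵖ}
    (t : (Δ[n] : SSet.{u}).obj d) :
    y.app d t = X.map (stdSimplex.objEquiv t).op (SSet.yonedaEquiv y) := by
  refine Eq.trans ?_ (NatTrans.naturality_apply y (stdSimplex.objEquiv t).op
    (stdSimplex.objEquiv.symm (𝟙 ⦋n⦌)))
  refine congrArg (y.app d) (stdSimplex.objEquiv.injective ?_)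
  ext i : 3
  rfl

/-- By adjunction, a lifting problem of a horn inclusion against `Ex.map p` is a lifting problem of
its subdivision against `p`. -/
theorem kanFibrations_Ex_map {p : X ⟶ Y} (hp : kanFibrations p) : kanFibrations (Ex.map p) := by
  intro n k
  refine ⟨fun {h y} sq => ?_⟩
  let y' : orderNerve.{u} (Faces (n + 1)) ⟶ Y := SSet.yonedaEquiv y
  have hy {d : SimplexCategoryᵒᵖ} (t : (Δ[n + 1] : SSet.{u}).obj d) :
      y.app d t = sdOf t ≫ y' := stdSimplex_hom_eq y t
  obtain ⟨x, hx, hx'⟩ := exists_lift_of_anodyne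
    (anodyne_onSet_hornFaces (n + 1) k (vertexFace_mem_hornFaces n k)) hp (f := sdDesc h)
    (g := y') (by
      ext e c
      let t := hornRetract.{u} (topOfChain c.1) (c.2 _)
      have h₁ := ConcreteCategory.congr_hom (congr_app sq.w _) t
      have h₂ := (h₁.trans (hy t.1))
      refine (congrArg (fun z : (Ex.obj Y).obj _ => evalEx z c.1) h₂).trans ?_
      refine congrArg (y'.app e) (ULift.ext _ _ ?_)
      ext i : 2
      exact Faces.map_retract_eq (le_topOfChain c.1 i))
  let l : Δ[n + 1] ⟶ Ex.obj X := (SSet.yonedaEquiv (X := Ex.obj X)).symm x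
  have hl {d : SimplexCategoryᵒᵖ} (t : (Δ[n + 1] : SSet.{u}).obj d) :
      l.app d t = sdOf t ≫ x :=
    (stdSimplex_hom_eq l t).trans
      (congrArg ((Ex.obj X).map _) ((SSet.yonedaEquiv (X := Ex.obj X)).apply_symm_apply x))
  refine ⟨⟨l, ?_, ?_⟩⟩
  · ext d t
    refine (hl t.1).trans (SSet.hom_ext fun e => ?_)
    ext c
    refine Eq.trans ?_ (evalEx_eq_sdDesc h t c).symm
    exact ConcreteCategory.congr_hom (congr_app hx e) ⟨_, sdOf_mem t c⟩
  · ext d t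
    refine Eq.trans ?_ (hy t).symm
    refine (congrArg ((Ex.map p).app d) (hl t)).trans ?_
    exact (Category.assoc _ _ _).trans (congrArg (fun z => sdOf t ≫ z) hx')

open Classical in
/-- A vertex attached to each face: the last vertex for the faces of the horn, and the vertex `k`
for the two other faces. -/
noncomputable def hornVertex {n : ℕ} (k : Fin (n + 1)) (S : Faces n) : Fin (n + 1) :=
  if S ∈ hornFaces n k then Faces.last n S else k

/-- The set of vertices attached to a set of faces in a chain. -/
noncomputable def hornVertices {n m : ℕ} (k : Fin (n + 1)) (c : Fin (m + 1) →o Faces n) :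
    Faces m →o Faces n where
  toFun S := ⟨S.1.image fun i => hornVertex k (c i), S.2.image _⟩
  monotone' _ _ h := Finset.image_subset_image h

theorem hornVertices_mem {n m : ℕ} {k : Fin (n + 1)} (hk : vertexFace n k ∈ hornFaces n k)
    (c : Fin (m + 1) →o Faces n) (S : Faces m) : hornVertices k c S ∈ hornFaces n k := by
  classical
  -- the largest element of the chain which belongs to the horn omits a vertex other than `k`
  by_cases h : (S.1.filter fun i => c i ∈ hornFaces n k).Nonempty
  · obtain ⟨j, hj, hj'⟩ := (Finset.mem_filter.1 (Finset.max'_mem _ h)).2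
    refine ⟨j, hj, fun h' => ?_⟩
    obtain ⟨i, hi, hij⟩ := Finset.mem_image.1 h'
    by_cases hc : c i ∈ hornFaces n k
    · rw [hornVertex, if_pos hc] at hij
      exact hj' (c.monotone (Finset.le_max' _ _ (Finset.mem_filter.2 ⟨hi, hc⟩))
        (hij ▸ Faces.last_mem _))
    · rw [hornVertex, if_neg hc] at hij
      exact hj hij.symm
  · refine mem_hornFaces_of_le (fun b hb => ?_) hk
    obtain ⟨i, hi, rfl⟩ := Finset.mem_image.1 hb
    rw [hornVertex, if_neg fun hc => h ⟨i, Finset.mem_filter.2 ⟨hi, hc⟩⟩]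
    exact Finset.mem_singleton_self k

/-- Kan's lemma: after one further extension, every horn in `Ex X` has a filler. The filler is
induced by `hornVertices`, which retracts the double subdivision of the simplex into the subdivision
of the horn and is induced by the last vertex map on the horn. -/
theorem exists_horn_filler_toEx {n : ℕ} {k : Fin (n + 2)}
    (h : (Λ[n + 1, k] : SSet.{u}) ⟶ Ex.obj X) :
    ∃ l : Δ[n + 1] ⟶ Ex.obj (Ex.obj X), Λ[n + 1, k].ι ≫ l = h ≫ toEx.app (Ex.obj X) := by
  have hk := vertexFace_mem_hornFaces n k
  let V {d : SimplexCategory} (c : Fin (d.len + 1) →o Faces (n + 1)) :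
      sdSimplex.{u}.obj d ⟶ (orderNerve.onSet (hornFaces (n + 1) k)) :=
    { app e := ↾fun b => ⟨(orderNerve.map (hornVertices k c)).app e b, fun _ =>
        hornVertices_mem hk _ _⟩ }
  let w : orderNerve.{u} (Faces (n + 1)) ⟶ Ex.obj X :=
    { app d := ↾fun c => (V (d := d.unop) c.down ≫ sdDesc h : sdSimplex.obj d.unop ⟶ X)
      naturality d d' g := by
        ext c
        refine SSet.hom_ext fun e => ?_
        ext b
        refine congrArg ((sdDesc h).app e) (Subtype.ext (ULift.ext _ _ ?_))
        ext i : 2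
        refine Subtype.ext ?_
        exact (Finset.image_image (s := (b.down i).1) (f := g.unop.toOrderHom)
          (g := fun i => hornVertex k (c.down i))).symm }
  let l : Δ[n + 1] ⟶ Ex.obj (Ex.obj X) := (SSet.yonedaEquiv (X := Ex.obj (Ex.obj X))).symm w
  have hl {d : SimplexCategoryᵒᵖ} (t : (Δ[n + 1] : SSet.{u}).obj d) :
      l.app d t = sdOf t ≫ w :=
    (stdSimplex_hom_eq l t).trans (congrArg ((Ex.obj (Ex.obj X)).map _)
      ((SSet.yonedaEquiv (X := Ex.obj (Ex.obj X))).apply_symm_apply w))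
  refine ⟨l, ?_⟩
  ext d t
  refine (hl t.1).trans (SSet.hom_ext fun e => ?_)
  ext c
  refine SSet.hom_ext fun e' => ?_
  ext b
  refine Eq.trans ?_ (evalEx_eq_sdDesc h t
    ((sdSimplex.map (lastVertices (m := e.unop) (n := d.unop) c.down)).app e' b)).symm
  refine congrArg ((sdDesc h).app e') (Subtype.ext (ULift.ext _ _ ?_))
  ext i : 2
  refine Subtype.ext (Eq.trans ?_ (Finset.image_image).symm)
  refine Finset.image_congr fun a _ => ?_
  exact (if_pos (sdOf_mem t c a)).trans (Faces.last_map _ _)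

/-! ### The last vertex map is anodyne -/

namespace Faces

variable {l m n : ℕ}

open Classical in
/-- The map between posets of faces that preserves unions, and sends a vertex `a` to the vertex
`f a` if `P a` holds and to the initial face with last vertex `f a` otherwise. -/
noncomputable def spread (f : Fin (m + 1) →o Fin (n + 1)) (P : Fin (m + 1) → Prop) :
    Faces m →o Faces n where
  toFun S := ⟨Finset.univ.filter fun b => ∃ a ∈ S.1, b = f a ∨ (¬ P a ∧ b ≤ f a), by
    obtain ⟨a, ha⟩ := S.2
    exact ⟨f a, Finset.mem_filter.2 ⟨Finset.mem_univ _, a, ha, .inl rfl⟩⟩⟩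
  monotone' S T h b hb := by
    obtain ⟨a, ha, hb⟩ := (Finset.mem_filter.1 hb).2
    exact Finset.mem_filter.2 ⟨Finset.mem_univ _, a, h ha, hb⟩

theorem mem_spread {f : Fin (m + 1) →o Fin (n + 1)} {P : Fin (m + 1) → Prop} {S : Faces m}
    {b : Fin (n + 1)} : b ∈ (spread f P S).1 ↔ ∃ a ∈ S.1, b = f a ∨ (¬ P a ∧ b ≤ f a) := by
  classical
  exact Finset.mem_filter.trans (and_iff_right (Finset.mem_univ _))

theorem map_eq_spread (f : Fin (m + 1) →o Fin (n + 1)) : map f = spread f fun _ => True := by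
  refine OrderHom.ext _ _ (funext fun S => Subtype.ext (Finset.ext fun b => ?_))
  simp only [mem_map, mem_spread, not_true, false_and, or_false, eq_comm]

theorem spread_id {P : Fin (m + 1) → Prop} (hP : ∀ a, P a) :
    spread OrderHom.id P = OrderHom.id := by
  rw [← map_id, map_eq_spread]
  congr 1
  exact funext fun a => eq_true (hP a)

/-- The composition rule from which all the identities between simplices of `Ex X` used below are
deduced: the predicates are composed as for the map which is spread, under a condition that the
initial faces produced by `g` are mapped by `f` to initial faces. -/
theorem spread_comp {f : Fin (m + 1) →o Fin (n + 1)} {P : Fin (m + 1) → Prop}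
    {g : Fin (l + 1) →o Fin (m + 1)} {Q : Fin (l + 1) → Prop}
    {h : Fin (l + 1) →o Fin (n + 1)} {M : Fin (l + 1) → Prop}
    (hfg : ∀ a, f (g a) = h a) (hM : ∀ a, M a ↔ Q a ∧ P (g a))
    (H : ∀ a, ¬ Q a → P (g a) → ∀ b ≤ f (g a), ∃ c ≤ g a, f c = b) :
    (spread f P).comp (spread g Q) = spread h M := by
  refine OrderHom.ext _ _ (funext fun S => Subtype.ext (Finset.ext fun b => ?_))
  change b ∈ (spread f P (spread g Q S)).1 ↔ _
  simp only [mem_spread]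
  constructor
  · rintro ⟨a', ⟨a, ha, rfl | ⟨hQ, haa'⟩⟩, hb⟩
    · refine ⟨a, ha, ?_⟩
      rw [← hfg]
      exact hb.imp_right fun hb => ⟨fun h => hb.1 ((hM a).1 h).2, hb.2⟩
    · refine ⟨a, ha, .inr ⟨fun h => hQ ((hM a).1 h).1, ?_⟩⟩
      rw [← hfg]
      obtain rfl | hb := hb
      · exact f.monotone haa'
      · exact hb.2.trans (f.monotone haa')
  · rintro ⟨a, ha, hb⟩
    rw [← hfg] at hb
    obtain rfl | ⟨hm, hb⟩ := hb
    · exact ⟨g a, ⟨a, ha, .inl rfl⟩, .inl rfl⟩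
    · by_cases hP : P (g a)
      · have hQ : ¬ Q a := fun hQ => hm ((hM a).2 ⟨hQ, hP⟩)
        obtain ⟨c, hc, rfl⟩ := H a hQ hP b hb
        exact ⟨c, ⟨a, ha, .inr ⟨hQ, hc⟩⟩, .inl rfl⟩
      · exact ⟨g a, ⟨a, ha, .inl rfl⟩, .inr ⟨hP, hb⟩⟩

end Faces

section

variable {l m n : ℕ}

/-- The `k`-th degeneracy, as a monotone map. -/
abbrev degen (k : Fin (n + 1)) : Fin (n + 2) →o Fin (n + 1) := (SimplexCategory.σ k).toOrderHom

/-- The `i`-th face, as a monotone map. -/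
abbrev face (i : Fin (n + 2)) : Fin (n + 1) →o Fin (n + 2) := (SimplexCategory.δ i).toOrderHom

/-- The idempotent monotone map that sends `i + 1` to `i` and fixes the other elements. -/
def collapse (n i : ℕ) : Fin (n + 1) →o Fin (n + 1) where
  toFun a := ⟨if (a : ℕ) = i + 1 then i else a, by split_ifs <;> omega⟩
  monotone' a b h := by
    have : (a : ℕ) ≤ b := h
    change (if (a : ℕ) = i + 1 then i else (a : ℕ)) ≤ if (b : ℕ) = i + 1 then i else (b : ℕ)
    split_ifs <;> omega

theorem coe_collapse (i : ℕ) (a : Fin (n + 1)) :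
    (collapse n i a : ℕ) = if (a : ℕ) = i + 1 then i else (a : ℕ) := rfl

theorem coe_degen (k : Fin (n + 1)) (a : Fin (n + 2)) :
    (degen k a : ℕ) = if (a : ℕ) ≤ k then (a : ℕ) else a - 1 := by
  change (Fin.predAbove k a : ℕ) = _
  split_ifs with h
  · rw [Fin.predAbove_of_le_castSucc _ _ h]; rfl
  · rw [Fin.predAbove_of_castSucc_lt _ _ (not_le.1 h)]; rfl

theorem coe_face (i : Fin (n + 2)) (a : Fin (n + 1)) :
    (face i a : ℕ) = if (a : ℕ) < i then (a : ℕ) else a + 1 := by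
  change (Fin.succAbove i a : ℕ) = _
  split_ifs with h
  · rw [Fin.succAbove_of_castSucc_lt _ _ h]; rfl
  · rw [Fin.succAbove_of_le_castSucc _ _ (not_lt.1 h)]; rfl

theorem exists_degen_eq (k : Fin (n + 1)) {a : Fin (n + 2)} {b : Fin (n + 1)}
    (h : b ≤ degen k a) : ∃ c ≤ a, degen k c = b := by
  have h' : (b : ℕ) ≤ _ := h
  rw [coe_degen] at h'
  have hb := b.2
  by_cases hb : (b : ℕ) ≤ k
  · refine ⟨b.castSucc, ?_, Fin.ext ?_⟩
    · change (b : ℕ) ≤ a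
      split_ifs at h' <;> omega
    · rw [coe_degen]
      exact if_pos hb
  · refine ⟨b.succ, ?_, Fin.ext ?_⟩
    · change (b : ℕ) + 1 ≤ a
      split_ifs at h' <;> omega
    · rw [coe_degen, Fin.val_succ]
      split_ifs <;> omega

/-- The action of monotone maps between posets of faces on the simplices of `Ex X`. -/
def exAct (φ : Faces m →o Faces n) (x : (Ex.obj X) _⦋n⦌) : (Ex.obj X) _⦋m⦌ :=
  (orderNerve.map φ ≫ x : orderNerve.{u} (Faces m) ⟶ X)

theorem exAct_exAct (φ : Faces m →o Faces n) (ψ : Faces l →o Faces m) (x : (Ex.obj X) _⦋n⦌) :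
    exAct ψ (exAct φ x) = exAct (φ.comp ψ) x := rfl

theorem exAct_spread {f : Fin (m + 1) →o Fin (n + 1)} {P : Fin (m + 1) → Prop}
    {g : Fin (l + 1) →o Fin (m + 1)} {Q : Fin (l + 1) → Prop}
    (h : Fin (l + 1) →o Fin (n + 1)) (M : Fin (l + 1) → Prop) (x : (Ex.obj X) _⦋n⦌)
    (hfg : ∀ a, (f (g a) : ℕ) = h a) (hM : ∀ a, M a ↔ Q a ∧ P (g a))
    (H : ∀ a, ¬ Q a → P (g a) → ∀ b ≤ f (g a), ∃ c ≤ g a, f c = b) :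
    exAct (Faces.spread g Q) (exAct (Faces.spread f P) x) = exAct (Faces.spread h M) x := by
  rw [exAct_exAct, Faces.spread_comp (fun a => Fin.ext (hfg a)) hM H]

theorem exAct_id (x : (Ex.obj X) _⦋n⦌) : exAct OrderHom.id x = x := rfl

theorem Ex_δ (i : Fin (n + 2)) (x : (Ex.obj X) _⦋n + 1⦌) :
    (Ex.obj X).δ i x = exAct (Faces.spread (face i) fun _ => True) x := by
  rw [← Faces.map_eq_spread]; rfl

theorem Ex_σ (i : Fin (n + 1)) (x : (Ex.obj X) _⦋n⦌) :
    (Ex.obj X).σ i x = exAct (Faces.spread (degen i) fun _ => True) x := by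
  rw [← Faces.map_eq_spread]; rfl

/-- A simplex invariant under collapsing `i + 1` to `i` is the degeneracy of one of its faces. -/
theorem mem_degenerate_of_collapse {i : ℕ} (hi : i < n) {x : (Ex.obj X) _⦋n⦌}
    (h : exAct (Faces.spread (collapse n i) fun _ => True) x = x) :
    x ∈ (Ex.obj X).degenerate n := by
  obtain _ | n := n
  · omega
  have : (Ex.obj X).σ ⟨i, hi⟩ ((Ex.obj X).δ ⟨i + 1, by omega⟩ x) = x := by
    rw [Ex_σ, Ex_δ, exAct_spread (collapse (n + 1) i) (fun _ => True) x, h]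
    · intro a
      rw [coe_face, coe_degen, coe_collapse]
      dsimp only
      split_ifs <;> omega
    · simp
    · simp
  rw [← this]
  exact σ_mem_degenerate _ _ _

theorem exists_of_mem_degenerate {x : (Ex.obj X) _⦋n + 1⦌}
    (h : x ∈ (Ex.obj X).degenerate (n + 1)) :
    ∃ i w, x = exAct (Faces.spread (degen i) fun _ => True) w := by
  rw [degenerate_eq_iUnion_range_σ, Set.mem_iUnion] at h
  obtain ⟨i, w, rfl⟩ := h
  exact ⟨i, w, Ex_σ i w⟩

/-- The filtration of `Ex X` that interpolates between `X` (for `k = 0`) and `Ex X`: a simplex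
has level at most `k` if it is invariant under the endomap of the poset of faces which spreads the
vertices larger than `k`. -/
def LevelLE (k : ℕ) (x : (Ex.obj X) _⦋n⦌) : Prop :=
  exAct (Faces.spread OrderHom.id fun a => (a : ℕ) ≤ k) x = x

/-- On a simplex of level at most `k`, the vertices sent above `k` may be spread freely. -/
theorem LevelLE.exAct_eq {k : ℕ} {x : (Ex.obj X) _⦋n⦌} (hx : LevelLE k x)
    {f : Fin (m + 1) →o Fin (n + 1)} {P : Fin (m + 1) → Prop} (M : Fin (m + 1) → Prop)
    (hM : ∀ a, M a ↔ P a ∧ (f a : ℕ) ≤ k) :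
    exAct (Faces.spread f P) x = exAct (Faces.spread f M) x := by
  conv_lhs => rw [← hx]
  exact exAct_spread _ _ _ (fun _ => rfl) hM (fun a _ _ b hb => ⟨b, hb, rfl⟩)

theorem levelLE_exAct {k : ℕ} (x : (Ex.obj X) _⦋n⦌)
    {f : Fin (m + 1) →o Fin (n + 1)} {P : Fin (m + 1) → Prop} (hP : ∀ a, P a → (a : ℕ) ≤ k) :
    LevelLE k (exAct (Faces.spread f P) x) :=
  exAct_spread _ _ _ (fun _ => rfl) (fun a => (and_iff_right_of_imp (hP a)).symm)
    (fun a h h' => absurd (hP a h') h)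

theorem LevelLE.mono {k k' : ℕ} (h : k ≤ k') {x : (Ex.obj X) _⦋n⦌} (hx : LevelLE k x) :
    LevelLE k' x := by
  rw [← hx]
  exact levelLE_exAct _ fun a ha => ha.trans h

theorem levelLE_dim (x : (Ex.obj X) _⦋n⦌) : LevelLE n x := by
  rw [LevelLE, Faces.spread_id fun a => Nat.lt_succ_iff.1 a.2, exAct_id]

theorem LevelLE.δ {k : ℕ} {x : (Ex.obj X) _⦋n + 1⦌} (hx : LevelLE k x) (i : Fin (n + 2)) :
    LevelLE k ((Ex.obj X).δ i x) := by
  rw [Ex_δ, hx.exAct_eq (fun a => (face i a : ℕ) ≤ k) (by simp)]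
  refine levelLE_exAct _ fun a ha => ?_
  rw [coe_face] at ha
  split_ifs at ha <;> omega

/-- The simplices of level `0` are those which depend only on the last vertices of faces, i.e. the
image of the last vertex map. -/
theorem levelLE_zero_iff (x : (Ex.obj X) _⦋n⦌) :
    LevelLE 0 x ↔ x ∈ (Subcomplex.range (toEx.app X)).obj _ := by
  have key (S : Faces n) : Faces.spread OrderHom.id (fun a => (a : ℕ) ≤ 0) S =
      ⟨Finset.Iic (Faces.last n S), ⟨_, Finset.mem_Iic.2 le_rfl⟩⟩ := by
    refine Subtype.ext (Finset.ext fun b => Faces.mem_spread.trans ?_)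
    rw [Finset.mem_Iic]
    constructor
    · rintro ⟨a, ha, rfl | ⟨-, h⟩⟩
      · exact Faces.le_last ha
      · exact h.trans (Faces.le_last ha)
    · intro h
      by_cases h₀ : ((Faces.last n S : Fin (n + 1)) : ℕ) ≤ 0
      · refine ⟨_, Faces.last_mem S, .inl (Fin.ext ?_)⟩
        have : (b : ℕ) ≤ (Faces.last n S : Fin (n + 1)) := h
        change (b : ℕ) = (Faces.last n S : Fin (n + 1))
        omega
      · exact ⟨_, Faces.last_mem S, .inr ⟨h₀, h⟩⟩
  constructor
  · intro hx
    let c : (orderNerve.{u} (Faces n)).obj (.op ⦋n⦌) :=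
      ⟨⟨fun i => ⟨Finset.Iic i, ⟨i, Finset.mem_Iic.2 le_rfl⟩⟩, fun i j hij a ha =>
        Finset.mem_Iic.2 ((Finset.mem_Iic.1 ha).trans hij)⟩⟩
    refine ⟨evalEx x c, ?_⟩
    refine Eq.trans (SSet.hom_ext fun e => ?_) hx
    ext d
    refine (NatTrans.naturality_apply (F := sdSimplex.obj ⦋n⦌) (G := X) x
      (lastVertices (m := e.unop) (n := ⦋n⦌) d.down).op c).symm.trans ?_
    refine congrArg (NatTrans.app (F := sdSimplex.obj ⦋n⦌) (G := X) x e) (ULift.ext _ _ ?_)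
    ext i : 2
    exact (key _).symm
  · rintro ⟨y, rfl⟩
    refine SSet.hom_ext fun e => ?_
    ext d
    refine congrArg (fun t : e.unop ⟶ ⦋n⦌ => X.map t.op y) ?_
    ext i : 3
    refine (congrArg (Faces.last n) (key (d.down i))).trans ?_
    exact Faces.last_eq (Finset.mem_Iic.2 le_rfl) fun b hb => Finset.mem_Iic.1 hb

end

section

variable {l m n : ℕ}

/-- The simplex which is paired with a simplex `x` of level `k`. -/
noncomputable def cone (k : Fin (n + 1)) (x : (Ex.obj X) _⦋n⦌) : (Ex.obj X) _⦋n + 1⦌ :=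
  exAct (Faces.spread (degen k) fun a => (a : ℕ) ≤ k) x

/-- The condition that a simplex of level `k` is of the form `cone k z`, stated without reference
to `z`. -/
def IsCone (k : ℕ) (x : (Ex.obj X) _⦋n⦌) : Prop :=
  k < n ∧ exAct (Faces.spread (collapse n k) fun a => (a : ℕ) ≤ k) x = x

theorem levelLE_cone (k : Fin (n + 1)) (x : (Ex.obj X) _⦋n⦌) : LevelLE k (cone k x) :=
  levelLE_exAct _ fun _ => id

theorem δ_cone (k : Fin (n + 1)) (i : Fin (n + 2)) (x : (Ex.obj X) _⦋n⦌) :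
    (Ex.obj X).δ i (cone k x) =
      exAct (Faces.spread ((degen k).comp (face i)) fun a => (face i a : ℕ) ≤ k) x := by
  rw [Ex_δ]
  exact exAct_spread _ _ _ (fun _ => rfl) (fun _ => by simp) (fun _ h => absurd trivial h)

/-- The simplex `x` is a face of `cone k x`, which makes them a candidate pair for a pairing. -/
theorem δ_succ_cone {k : Fin (n + 1)} {x : (Ex.obj X) _⦋n⦌} (hx : LevelLE k x) :
    (Ex.obj X).δ k.succ (cone k x) = x := by
  rw [δ_cone]
  refine Eq.trans ?_ hx
  congr 2
  · refine OrderHom.ext _ _ (funext fun a => Fin.ext ?_)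
    change (degen k (face k.succ a) : ℕ) = a
    rw [coe_degen, coe_face, Fin.val_succ]
    split_ifs <;> omega
  · ext a
    rw [coe_face, Fin.val_succ]
    split_ifs <;> omega

theorem levelLE_δ_cone {k : Fin (n + 1)} {i : Fin (n + 2)} (x : (Ex.obj X) _⦋n⦌)
    (hi : (i : ℕ) ≤ k) {j : ℕ} (hj : (k : ℕ) ≤ j + 1) :
    LevelLE j ((Ex.obj X).δ i (cone k x)) := by
  rw [δ_cone]
  refine levelLE_exAct _ fun a ha => ?_
  rw [coe_face] at ha
  split_ifs at ha <;> omega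

/-- The faces of `cone k x` of large index are again cones of the same level. -/
theorem δ_cone_of_gt {k : Fin (n + 1)} {i : Fin (n + 2)} (x : (Ex.obj X) _⦋n⦌)
    (hi : (k : ℕ) + 1 < i) :
    LevelLE k ((Ex.obj X).δ i (cone k x)) ∧ IsCone k ((Ex.obj X).δ i (cone k x)) := by
  have hi' := i.2
  have hface (a : Fin (n + 1)) : (face i a : ℕ) ≤ k ↔ (a : ℕ) ≤ k := by
    rw [coe_face]
    split_ifs <;> omega
  have hval (a : Fin (n + 1)) (ha : (a : ℕ) ≤ k) : (degen k (face i a) : ℕ) = a := by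
    rw [coe_degen, coe_face]
    split_ifs <;> omega
  rw [δ_cone]
  refine ⟨levelLE_exAct _ fun a ha => (hface a).1 ha, by omega, ?_⟩
  refine exAct_spread _ _ _ (fun a => ?_) (fun a => ?_) (fun a h h' b hb => ?_)
  · change (degen k (face i (collapse n k a)) : ℕ) = degen k (face i a)
    rw [coe_degen, coe_face, coe_degen, coe_face, coe_collapse]
    split_ifs <;> omega
  · rw [hface, hface, coe_collapse]
    split_ifs <;> omega
  · rw [hface] at h'
    have hb' : (b : ℕ) ≤ degen k (face i (collapse n k a)) := hb
    rw [hval _ h'] at hb'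
    exact ⟨b, hb', Fin.ext (hval b (hb'.trans h'))⟩

theorem isCone_cone (k : Fin (n + 1)) (x : (Ex.obj X) _⦋n⦌) : IsCone k (cone k x) := by
  refine ⟨k.2, exAct_spread _ _ _ (fun a => ?_) (fun a => ?_)
    (fun a _ _ b hb => exists_degen_eq k hb)⟩
  · rw [coe_degen, coe_degen, coe_collapse]
    split_ifs <;> omega
  · rw [coe_collapse]
    split_ifs <;> omega

/-- A simplex satisfying `IsCone` is the cone of one of its faces. -/
theorem IsCone.eq_cone {k : Fin (n + 1)} {x : (Ex.obj X) _⦋n + 1⦌} (hx : LevelLE k x)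
    (h : IsCone k x) : cone k ((Ex.obj X).δ k.succ x) = x := by
  refine Eq.trans ?_ h.2
  have hface (a : Fin (n + 1)) : (face k.succ a : ℕ) ≤ k ↔ (a : ℕ) ≤ k := by
    rw [coe_face, Fin.val_succ]
    split_ifs <;> omega
  rw [Ex_δ, hx.exAct_eq (fun a => (a : ℕ) ≤ k) (fun a => by rw [hface]; simp)]
  refine exAct_spread _ _ _ (fun a => ?_) (fun a => ?_) (fun a h h' b hb => ?_)
  · rw [coe_face, coe_degen, coe_collapse, Fin.val_succ]
    split_ifs <;> omega
  · rw [coe_degen]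
    split_ifs <;> omega
  · have hb' : (b : ℕ) ≤ face k.succ (degen k a) := hb
    rw [coe_face, Fin.val_succ, if_pos (Nat.lt_succ_of_le h')] at hb'
    have hb'' := hb'.trans h'
    refine ⟨⟨b, by omega⟩, hb', Fin.ext ?_⟩
    rw [coe_face, Fin.val_succ]
    exact if_pos (Nat.lt_succ_of_le hb'')

/-- If `cone k x` were the degeneracy `σ i` of a simplex, then, according to the position of `i`
with respect to `k`, either `x` would be degenerate, or of level at most `k - 1`, or a cone. -/
theorem cone_nonDegenerate {k : Fin (n + 1)} {x : (Ex.obj X) _⦋n⦌}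
    (hx : x ∈ (Ex.obj X).nonDegenerate n) (hk : LevelLE k x)
    (hk₀ : 0 < (k : ℕ)) (hk' : ∀ j : ℕ, j < k → ¬ LevelLE j x) (hc : ¬ IsCone k x) :
    cone k x ∈ (Ex.obj X).nonDegenerate (n + 1) := by
  intro h
  obtain ⟨i, v, hv⟩ := exists_of_mem_degenerate h
  have hδ (j : Fin (n + 2)) : (Ex.obj X).δ j (cone k x) =
      exAct (Faces.spread ((degen i).comp (face j)) fun _ => True) v := by
    rw [hv, Ex_δ]
    exact exAct_spread _ _ _ (fun _ => rfl) (by simp) (by simp)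
  have hxv := (δ_succ_cone hk).symm.trans (hδ k.succ)
  have hi := i.2
  have hk₁ := k.2
  -- `x` is degenerate as soon as it is obtained from `v` through a map collapsing `j` and `j + 1`
  have hdeg (j : ℕ) (hj : j < n) (H : ∀ a : Fin (n + 1),
      (degen i (face k.succ (collapse n j a)) : ℕ) = degen i (face k.succ a)) : False := by
    refine hx (mem_degenerate_of_collapse hj ?_)
    rw [hxv]
    exact exAct_spread _ _ _ H (by simp) (by simp)
  obtain h | h | h | h : (i : ℕ) < k ∨ (i : ℕ) = k ∨ (i : ℕ) = k + 1 ∨ (k : ℕ) + 1 < i := by omega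
  · refine hdeg i (by omega) fun a => ?_
    rw [coe_degen, coe_face, coe_degen, coe_face, coe_collapse, Fin.val_succ]
    split_ifs <;> omega
  · refine hk' (k - 1) (by omega) ?_
    have : x = (Ex.obj X).δ k.castSucc (cone k x) := by
      rw [hδ, hxv]
      congr 2
      refine OrderHom.ext _ _ (funext fun a => Fin.ext ?_)
      change (degen i (face k.succ a) : ℕ) = degen i (face k.castSucc a)
      rw [coe_degen, coe_face, coe_degen, coe_face, Fin.val_succ, Fin.val_castSucc]
      split_ifs <;> omega
    rw [this]
    exact levelLE_δ_cone x le_rfl (by omega)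
  · have hkn : (k : ℕ) < n := by omega
    refine hc ⟨hkn, ?_⟩
    let j : Fin (n + 2) := ⟨k + 2, by omega⟩
    have hj : (j : ℕ) = k + 2 := rfl
    have h₁ : (Ex.obj X).δ j (cone k x) = x := by
      rw [hδ, hxv]
      congr 2
      refine OrderHom.ext _ _ (funext fun a => Fin.ext ?_)
      change (degen i (face j a) : ℕ) = degen i (face k.succ a)
      rw [coe_degen, coe_face, coe_degen, coe_face, Fin.val_succ, hj]
      split_ifs <;> omega
    refine Eq.trans ?_ h₁
    rw [δ_cone]
    congr 2
    · refine OrderHom.ext _ _ (funext fun a => Fin.ext ?_)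
      change (collapse n k a : ℕ) = degen k (face j a)
      rw [coe_degen, coe_face, coe_collapse, hj]
      split_ifs <;> omega
    · ext a
      rw [coe_face, hj]
      split_ifs <;> omega
  · refine hdeg (i - 1) (by omega) fun a => ?_
    rw [coe_degen, coe_face, coe_degen, coe_face, coe_collapse, Fin.val_succ]
    split_ifs <;> omega

theorem levelLE_of_cone {k : Fin (n + 1)} {x : (Ex.obj X) _⦋n⦌} (hk : LevelLE k x) {j : ℕ}
    (h : LevelLE j (cone k x)) : LevelLE j x :=
  δ_succ_cone hk ▸ h.δ k.succ

theorem levelLE_cone_of_levelLE {k : Fin (n + 1)} {z : (Ex.obj X) _⦋n⦌} {j : ℕ} (hj : j < k)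
    (hz : LevelLE j z) : LevelLE j (cone k z) := by
  rw [cone, hz.exAct_eq (fun a => (a : ℕ) ≤ j)]
  · exact levelLE_exAct _ fun _ => id
  · intro a
    rw [coe_degen]
    split_ifs <;> omega

/-- If `cone k z` is nondegenerate and has level exactly `k`, then `z` is nondegenerate and is
not itself a cone. -/
theorem nonDegenerate_of_cone {k : Fin (n + 1)} {z : (Ex.obj X) _⦋n⦌} (hz : LevelLE k z)
    (hy : cone k z ∈ (Ex.obj X).nonDegenerate (n + 1)) (hk₀ : 0 < (k : ℕ))
    (hk : ∀ j : ℕ, j < k → ¬ LevelLE j (cone k z)) :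
    z ∈ (Ex.obj X).nonDegenerate n ∧ ¬ IsCone k z := by
  have hk₁ := k.2
  constructor
  · intro h
    obtain _ | n := n
    · simp at h
    obtain ⟨i, w, rfl⟩ := exists_of_mem_degenerate h
    have hi := i.2
    by_cases hik : (i : ℕ) = k
    · -- here `z` is a degeneracy of a face of level at most `k - 1`
      have hw : w = (Ex.obj X).δ i.castSucc (exAct (Faces.spread (degen i) fun _ => True) w) := by
        rw [Ex_δ, exAct_spread OrderHom.id (fun _ => True) w (fun a => ?_) (by simp) (by simp),
          Faces.spread_id fun _ => trivial, exAct_id]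
        rw [coe_degen, coe_face, Fin.val_castSucc]
        change _ = (a : ℕ)
        split_ifs <;> omega
      have hw' : LevelLE (k - 1) w := by
        rw [hw, Ex_δ, hz.exAct_eq (fun a => (face i.castSucc a : ℕ) ≤ k) (by simp)]
        refine levelLE_exAct _ fun a ha => ?_
        rw [coe_face, Fin.val_castSucc] at ha
        split_ifs at ha <;> omega
      refine hk (k - 1) (by omega) (levelLE_cone_of_levelLE (by omega) ?_)
      rw [hw'.exAct_eq (fun a => (degen i a : ℕ) ≤ k - 1) (by simp)]
      refine levelLE_exAct _ fun a ha => ?_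
      rw [coe_degen] at ha
      split_ifs at ha <;> omega
    · have key : cone k (exAct (Faces.spread (degen i) fun _ => True) w) =
          exAct (Faces.spread ((degen i).comp (degen k)) fun a => (a : ℕ) ≤ k) w :=
        exAct_spread _ _ _ (fun _ => rfl) (by simp) (fun a _ _ b hb => exists_degen_eq i hb)
      obtain ⟨j, hj⟩ : ∃ j : ℕ, ((i : ℕ) < k ∧ j = i) ∨ ((k : ℕ) < i ∧ j = i + 1) := by
        obtain h | h := Nat.lt_or_gt_of_ne hik
        exacts [⟨i, .inl ⟨h, rfl⟩⟩, ⟨i + 1, .inr ⟨h, rfl⟩⟩]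
      refine hy (mem_degenerate_of_collapse (i := j) (by omega) ?_)
      rw [key]
      refine exAct_spread _ _ _ (fun a => ?_) (fun a => ?_) (by simp)
      · change (degen i (degen k (collapse _ j a)) : ℕ) = degen i (degen k a)
        rw [coe_degen, coe_degen, coe_degen, coe_degen, coe_collapse]
        split_ifs <;> omega
      · rw [coe_collapse, true_and]
        split_ifs <;> omega
  · intro h
    obtain _ | n := n
    · exact absurd h.1 (by omega)
    have hkn := h.1
    let k' : Fin (n + 1) := ⟨k, hkn⟩
    have hk' : (k' : ℕ) = k := rfl
    have h' := IsCone.eq_cone (k := k') hz h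
    generalize (Ex.obj X).δ k'.succ z = w at h'
    have key : cone k z = exAct (Faces.spread ((degen k').comp (degen k))
        fun a => (a : ℕ) ≤ k) w := by
      rw [← h']
      refine exAct_spread _ _ _ (fun _ => rfl) (fun a => ?_)
        (fun a _ _ b hb => exists_degen_eq _ hb)
      rw [coe_degen]
      split_ifs <;> omega
    refine hy (mem_degenerate_of_collapse (i := k + 1) (by omega) ?_)
    rw [key]
    refine exAct_spread _ _ _ (fun a => ?_) (fun a => ?_) (by simp)
    · change (degen k' (degen k (collapse _ (k + 1) a)) : ℕ) = degen k' (degen k a)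
      rw [coe_degen, coe_degen, coe_degen, coe_degen, coe_collapse]
      split_ifs <;> omega
    · rw [coe_collapse, true_and]
      split_ifs <;> omega

end

theorem exists_δ_of_map_eq {n m : ℕ} (x : Z _⦋n⦌) (y : Z _⦋m + 1⦌) (hnm : n = m)
    (f : ⦋n⦌ ⟶ ⦋m + 1⦌) (hf : Mono f) (h : Z.map f.op y = x) :
    ∃ i, S.mk x = S.mk (Z.δ i y) := by
  subst hnm h
  obtain ⟨i, rfl⟩ := SimplexCategory.eq_δ_of_mono f
  exact ⟨i, rfl⟩

/-- A nondegenerate simplex of `Ex X` of level exactly `k > 0` which is not a cone. These are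
the simplices of type (II) of a pairing for the image of `X` in `Ex X`, that is, those which are
added as the missing face of a horn, together with their cone. -/
structure TypeTwo (X : SSet.{u}) where
  {dim : ℕ}
  level : Fin (dim + 1)
  simplex : (Ex.obj X) _⦋dim⦌
  nonDegenerate : simplex ∈ (Ex.obj X).nonDegenerate dim
  levelLE : LevelLE level simplex
  pos : 0 < (level : ℕ)
  not_levelLE : ∀ j : ℕ, j < level → ¬ LevelLE j simplex
  not_isCone : ¬ IsCone level simplex

namespace TypeTwo

theorem not_levelLE_cone (s : TypeTwo X) {j : ℕ} (hj : j < s.level) :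
    ¬ LevelLE j (cone s.level s.simplex) :=
  fun h => s.not_levelLE j hj (levelLE_of_cone s.levelLE h)

theorem eq_of_simplex_eq {s t : TypeTwo X} (h : S.mk s.simplex = S.mk t.simplex) : s = t := by
  obtain @⟨n, k, x, h₁, h₂, h₃, h₄, h₅⟩ := s
  obtain @⟨m, l, y, h₁', h₂', h₃', h₄', h₅'⟩ := t
  obtain rfl : n = m := S.dim_eq_of_mk_eq h
  obtain rfl : x = y := (S.ext_iff _ _).1 h
  obtain rfl : k = l := by
    refine Fin.ext (le_antisymm ?_ ?_)
    · exact not_lt.1 fun h => h₄ _ h h₂'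
    · exact not_lt.1 fun h => h₄' _ h h₂
  rfl

theorem eq_of_cone_eq {s t : TypeTwo X}
    (h : S.mk (cone s.level s.simplex) = S.mk (cone t.level t.simplex)) : s = t := by
  refine eq_of_simplex_eq ?_
  obtain @⟨n, k, x, h₁, h₂, h₃, h₄, h₅⟩ := s
  obtain @⟨m, l, y, h₁', h₂', h₃', h₄', h₅'⟩ := t
  obtain rfl : n = m := Nat.succ_injective (S.dim_eq_of_mk_eq h)
  dsimp only at h ⊢
  have h : cone k x = cone l y := (S.ext_iff _ _).1 h
  obtain rfl : k = l := by
    refine Fin.ext (le_antisymm ?_ ?_)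
    · exact not_lt.1 fun hlt => h₄ _ hlt (levelLE_of_cone h₂ (h ▸ levelLE_cone l y))
    · exact not_lt.1 fun hlt => h₄' _ hlt (levelLE_of_cone h₂' (h ▸ levelLE_cone k x))
  rw [← δ_succ_cone h₂, ← δ_succ_cone h₂', h]

theorem cone_ne_simplex (s t : TypeTwo X) :
    S.mk (cone s.level s.simplex) ≠ S.mk t.simplex := by
  intro h
  obtain @⟨n, k, x, h₁, h₂, h₃, h₄, h₅⟩ := s
  obtain @⟨m, l, y, h₁', h₂', h₃', h₄', h₅'⟩ := t
  obtain rfl : n + 1 = m := S.dim_eq_of_mk_eq h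
  dsimp only at h
  have h : cone k x = y := (S.ext_iff _ _).1 h
  subst h
  have hkl : (k : ℕ) = l := by
    refine le_antisymm ?_ ?_
    · exact not_lt.1 fun hlt => h₄ _ hlt (levelLE_of_cone h₂ h₂')
    · exact not_lt.1 fun hlt => h₄' _ hlt (levelLE_cone k x)
  exact h₅' (hkl ▸ isCone_cone k x)

/-- Every nondegenerate simplex of `Ex X` outside the image of `X` belongs to a pair, as a cone or as
a simplex of type (II), with respect to the least `k` for which it has level at most `k`. -/
theorem exists_of_nonDegenerate {n : ℕ} (y : (Ex.obj X) _⦋n⦌)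
    (hy : y ∈ (Ex.obj X).nonDegenerate n) (hy' : y ∉ (Subcomplex.range (toEx.app X)).obj _) :
    ∃ s : TypeTwo X, S.mk y = S.mk (cone s.level s.simplex) ∨ S.mk y = S.mk s.simplex := by
  classical
  have hex : ∃ k, LevelLE k y := ⟨n, levelLE_dim y⟩
  obtain ⟨k, hk, hmin⟩ : ∃ k, LevelLE k y ∧ ∀ j < k, ¬ LevelLE j y :=
    ⟨Nat.find hex, Nat.find_spec hex, fun j => Nat.find_min hex⟩
  have hkn : k < n + 1 := Nat.lt_succ_of_le (not_lt.1 fun h => hmin n h (levelLE_dim y))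
  have hpos : 0 < k := Nat.pos_of_ne_zero fun h => hy' ((levelLE_zero_iff y).1 (h ▸ hk))
  by_cases hc : IsCone k y
  · obtain _ | n := n
    · exact absurd hc.1 (by omega)
    let k' : Fin (n + 1) := ⟨k, hc.1⟩
    have h := IsCone.eq_cone (k := k') hk hc
    have hz : LevelLE k' ((Ex.obj X).δ k'.succ y) := LevelLE.δ hk _
    obtain ⟨h₁, h₂⟩ := nonDegenerate_of_cone hz (h.symm ▸ hy) hpos (h.symm ▸ hmin)
    refine ⟨⟨k', _, h₁, hz, hpos, fun j hj h' => hmin j hj ?_, h₂⟩, .inl (congrArg S.mk h.symm)⟩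
    rw [← h]
    exact levelLE_cone_of_levelLE hj h'
  · exact ⟨⟨⟨k, hkn⟩, y, hy, hk, hpos, hmin, hc⟩, .inr rfl⟩

theorem δ_cone (s : TypeTwo X) :
    (Ex.obj X).δ s.level.succ (cone s.level s.simplex) = s.simplex :=
  δ_succ_cone s.levelLE

/-- The faces of `cone k x` other than `x` are of lower level, or are themselves cones. -/
theorem δ_cone_eq (t : TypeTwo X) (i : Fin (t.dim + 2)) :
    i = t.level.succ ∨ LevelLE (t.level - 1) ((Ex.obj X).δ i (cone t.level t.simplex)) ∨
      (LevelLE t.level ((Ex.obj X).δ i (cone t.level t.simplex)) ∧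
        IsCone t.level ((Ex.obj X).δ i (cone t.level t.simplex))) := by
  obtain h | h | h := lt_trichotomy (i : ℕ) (t.level + 1)
  · exact .inr (.inl (levelLE_δ_cone _ (by omega) (by omega)))
  · exact .inl (Fin.ext h)
  · exact .inr (.inr (δ_cone_of_gt _ h))

/-- The level increases strictly along the ancestrality relation of the pairing. -/
theorem level_lt_of_δ_cone {s t : TypeTwo X} (i : Fin (t.dim + 2))
    (h : S.mk s.simplex = S.mk ((Ex.obj X).δ i (cone t.level t.simplex)))
    (hi : i ≠ t.level.succ) : (s.level : ℕ) < t.level := by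
  have ht := t.pos
  have key := (t.δ_cone_eq i).resolve_left hi
  obtain @⟨n, k, x, h₁, h₂, h₃, h₄, h₅⟩ := s
  dsimp only at h ⊢
  obtain rfl : n = t.dim := S.dim_eq_of_mk_eq h
  rw [← (S.ext_iff _ _).1 h] at key
  obtain key | ⟨key, key'⟩ := key
  · have := not_lt.1 fun h => h₄ _ h key
    omega
  · refine lt_of_le_of_ne (not_lt.1 fun h => h₄ _ h key) fun h => h₅ ?_
    rwa [h]

/-- The pairing for the image of `X` in `Ex X`: a simplex `x` of type (II) of level `k` is paired
with `cone k x`. -/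
noncomputable def pairingCore (X : SSet.{u}) :
    (Subcomplex.range (toEx.app X)).PairingCore where
  ι := TypeTwo X
  dim s := s.dim
  simplex s := cone s.level s.simplex
  index s := s.level.succ
  nonDegenerate₁ s := cone_nonDegenerate s.nonDegenerate s.levelLE s.pos s.not_levelLE s.not_isCone
  nonDegenerate₂ s := by rw [s.δ_cone]; exact s.nonDegenerate
  notMem₁ s h := s.not_levelLE_cone s.pos ((levelLE_zero_iff _).2 h)
  notMem₂ s h := by
    rw [s.δ_cone, ← levelLE_zero_iff] at h
    exact s.not_levelLE 0 s.pos h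
  injective_type₁' h := eq_of_cone_eq h
  injective_type₂' {s t} h := by
    rw [s.δ_cone, t.δ_cone] at h
    exact eq_of_simplex_eq h
  type₁_ne_type₂' s t := by rw [t.δ_cone]; exact cone_ne_simplex s t
  surjective' x := by
    obtain ⟨s, hs⟩ := exists_of_nonDegenerate x.simplex x.nonDegenerate x.notMem
    refine ⟨s, ?_⟩
    rw [s.δ_cone]
    exact hs

instance : (pairingCore X).IsProper where
  isUniquelyCodimOneFace s := by
    refine (S.IsUniquelyCodimOneFace.iff _ _).2 ⟨s.level.succ, rfl, fun i hi => ?_⟩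
    by_contra h
    refine lt_irrefl _ (level_lt_of_δ_cone (s := s) (t := s) i (congrArg S.mk ?_) h)
    exact (hi.trans s.δ_cone).symm

/-- The level is a rank function. -/
noncomputable def weakRankFunction (X : SSet.{u}) : (pairingCore X).WeakRankFunction ℕ where
  rank s := TypeTwo.level (X := X) s
  lt {s t} h hdim := by
    obtain ⟨hne, hlt⟩ := h
    have hdim : TypeTwo.dim (X := X) s = TypeTwo.dim (X := X) t := hdim
    obtain ⟨f, hf, hf'⟩ := SSet.N.le_iff_exists_mono.1 (Subcomplex.N.lt_iff.1 hlt).le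
    obtain ⟨i, hi⟩ := exists_δ_of_map_eq _ _ hdim f hf hf'
    refine level_lt_of_δ_cone (s := s) (t := t) i ?_ fun h => hne ?_
    · exact (congrArg S.mk (δ_cone s)).symm.trans hi
    · exact eq_of_simplex_eq ((congrArg S.mk (δ_cone s)).symm.trans
        (hi.trans (congrArg S.mk (h ▸ δ_cone t))))

end TypeTwo

/-- The last vertex map `X ⟶ Ex X` is an anodyne extension. -/
theorem anodyneExtensions_toEx (X : SSet.{u}) : anodyneExtensions (toEx.app X) := by
  have := (TypeTwo.weakRankFunction X).isRegular
  exact strongAnodyneExtensions_le_anodyneExtensions _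
    ⟨inferInstance, (TypeTwo.pairingCore X).pairing, inferInstance⟩

/-! ### The functor `Ex^∞` -/

instance isStableUnderFilteredColimits_monomorphisms :
    MorphismProperty.IsStableUnderFilteredColimits.{0, 0}
      (MorphismProperty.monomorphisms SSet.{u}) where
  isStableUnderColimitsOfShape J _ _ := by
    change (MorphismProperty.monomorphisms (_ ⥤ _)).IsStableUnderColimitsOfShape J
    rw [← MorphismProperty.functorCategory_monomorphisms]
    infer_instance

section

variable {F G : ℕ ⥤ SSet.{u}}

/-- Finite simplicial sets are compact with respect to sequential colimits. -/
instance preservesColimitsOfShape_coyoneda_nat (K : SSet.{u}) [K.Finite] :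
    PreservesColimitsOfShape ℕ (coyoneda.obj (.op K)) := by
  have := Cardinal.fact_isRegular_aleph0.{u}
  have : IsCardinalFiltered ℕ Cardinal.aleph0.{u} := by
    rw [isCardinalFiltered_aleph0_iff]; infer_instance
  exact preservesColimitsOfShape_of_isCardinalPresentable_of_essentiallySmall K Cardinal.aleph0 ℕ

theorem exists_factorization {K : SSet.{u}} [K.Finite] (f : K ⟶ colimit F) :
    ∃ (j : ℕ) (g : K ⟶ F.obj j), g ≫ colimit.ι F j = f :=
  exists_hom_of_preservesColimit_coyoneda (colimit.isColimit F) f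

theorem exists_eq_of_comp_ι_eq {K : SSet.{u}} [K.Finite] {j : ℕ} {f g : K ⟶ F.obj j}
    (h : f ≫ colimit.ι F j = g ≫ colimit.ι F j) :
    ∃ (k : ℕ) (a : j ⟶ k), f ≫ F.map a = g ≫ F.map a :=
  exists_eq_of_preservesColimit_coyoneda_self (colimit.isColimit F) f g h

/-- Lifting problems between finite simplicial sets and a sequential colimit of maps come from a
finite stage. -/
theorem exists_stage {K L : SSet.{u}} [K.Finite] [L.Finite] (i : K ⟶ L) (α : F ⟶ G)
    (f : K ⟶ colimit F) (g : L ⟶ colimit G) (w : f ≫ colimMap α = i ≫ g) :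
    ∃ (j : ℕ) (f' : K ⟶ F.obj j) (g' : L ⟶ G.obj j), f' ≫ colimit.ι F j = f ∧
      g' ≫ colimit.ι G j = g ∧ f' ≫ α.app j = i ≫ g' := by
  obtain ⟨a, f, rfl⟩ := exists_factorization f
  obtain ⟨b, g, rfl⟩ := exists_factorization g
  let f' := f ≫ F.map (homOfLE (le_max_left a b))
  let g' := g ≫ G.map (homOfLE (le_max_right a b))
  obtain ⟨k, u, h⟩ := exists_eq_of_comp_ι_eq (F := G) (f := f' ≫ α.app _) (g := i ≫ g')
    (by simpa [f', g'] using w)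
  refine ⟨k, f' ≫ F.map u, g' ≫ G.map u, by simp [f'], by simp [g'], ?_⟩
  simpa using h

theorem kanFibrations_colimMap (α : F ⟶ G) (h : ∀ n, kanFibrations (α.app n)) :
    kanFibrations (colimMap α) := by
  intro n k
  refine ⟨fun {f g} sq => ?_⟩
  obtain ⟨j, f, g, rfl, rfl, w⟩ := exists_stage _ α f g sq.w
  have := h j n k
  have sq' : CommSq f (Λ[n + 1, k] : (Δ[n + 1] : SSet.{u}).Subcomplex).ι (α.app j) g := ⟨w⟩
  exact ⟨⟨sq'.lift ≫ colimit.ι F j, by simp, by simp⟩⟩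

end

/-- The iterates of the functor `Ex`. -/
def exIter (n : ℕ) : SSet.{u} ⥤ SSet.{u} :=
  match n with
  | 0 => 𝟭 _
  | n + 1 => exIter n ⋙ Ex

instance preservesLimitsOfShape_exIter (n : ℕ) :
    PreservesLimitsOfShape WalkingCospan (exIter.{u} n) := by
  induction n with
  | zero => exact inferInstanceAs (PreservesLimitsOfShape WalkingCospan (𝟭 _))
  | succ n hn => exact inferInstanceAs (PreservesLimitsOfShape WalkingCospan (exIter n ⋙ Ex))

/-- The transition maps of the sequence of iterates of `Ex`. -/
def exStep (n : ℕ) : exIter.{u} n ⟶ exIter (n + 1) := Functor.whiskerLeft (exIter n) toEx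

theorem anodyneExtensions_exStep (n : ℕ) (X : SSet.{u}) :
    anodyneExtensions ((exStep n).app X) := anodyneExtensions_toEx _

instance (n : ℕ) (X : SSet.{u}) : Mono ((exStep n).app X) :=
  inferInstanceAs (Mono (toEx.app _))

/-- The natural map from a simplicial set to its iterated extensions. -/
def toExIter (n : ℕ) (X : SSet.{u}) : X ⟶ (exIter n).obj X :=
  match n with
  | 0 => 𝟙 X
  | n + 1 => toExIter n X ≫ (exStep n).app X

theorem toExIter_naturality (n : ℕ) (p : X ⟶ Y) :
    toExIter n X ≫ (exIter n).map p = p ≫ toExIter n Y := by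
  induction n with
  | zero => exact (Category.id_comp p).trans (Category.comp_id p).symm
  | succ n hn =>
    refine (Category.assoc _ _ _).trans ?_
    rw [← (exStep n).naturality p, reassoc_of% hn]
    rfl

theorem anodyneExtensions_toExIter (n : ℕ) (X : SSet.{u}) :
    anodyneExtensions (toExIter n X) := by
  induction n with
  | zero => exact anodyneExtensions.of_isIso (𝟙 X)
  | succ n hn => exact anodyneExtensions.comp_mem _ _ hn (anodyneExtensions_exStep n X)

theorem kanFibrations_exIter_map {p : X ⟶ Y} (hp : kanFibrations p) (n : ℕ) :
    kanFibrations ((exIter n).map p) := by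
  induction n with
  | zero => exact hp
  | succ n hn => exact kanFibrations_Ex_map hn

/-- The sequence `X ⟶ Ex X ⟶ Ex (Ex X) ⟶ ⋯`. -/
def exSequence (X : SSet.{u}) : ℕ ⥤ SSet.{u} :=
  Functor.ofSequence (X := fun n => (exIter n).obj X) fun n => (exStep n).app X

theorem exSequence_map_succ (X : SSet.{u}) (n : ℕ) :
    (exSequence X).map (homOfLE n.le_succ) = (exStep n).app X :=
  Functor.ofSequence_map_homOfLE_succ _ n

/-- The map of sequences of iterated extensions induced by a map. -/
def exSequenceMap (p : X ⟶ Y) : exSequence X ⟶ exSequence Y :=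
  NatTrans.ofSequence (F := exSequence X) (G := exSequence Y) (fun n => (exIter n).map p)
    fun n => by
      rw [exSequence_map_succ, exSequence_map_succ]
      exact ((exStep n).naturality p).symm

theorem exSequence_map_zero (X : SSet.{u}) (n : ℕ) :
    (exSequence X).map (homOfLE n.zero_le) = toExIter n X := by
  induction n with
  | zero => exact (exSequence X).map_id 0
  | succ n hn =>
    have : (exSequence X).map (homOfLE (n + 1).zero_le) =
        (exSequence X).map (homOfLE n.zero_le) ≫ (exSequence X).map (homOfLE n.le_succ) :=
      (exSequence X).map_comp (homOfLE n.zero_le) (homOfLE n.le_succ)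
    rw [this, hn, exSequence_map_succ]
    rfl

/-- The simplicial set `Ex^∞ X`, the colimit of the iterated extensions of `X`. -/
noncomputable def ExInf (X : SSet.{u}) : SSet.{u} := colimit (exSequence X)

/-- The functoriality of `Ex^∞`. -/
noncomputable def ExInf.map (p : X ⟶ Y) : ExInf X ⟶ ExInf Y := colimMap (exSequenceMap p)

/-- The canonical map from an iterated extension to `Ex^∞ X`. -/
noncomputable def ExInf.ι (X : SSet.{u}) (n : ℕ) : (exIter n).obj X ⟶ ExInf X :=
  colimit.ι (exSequence X) n

theorem exStep_ι (X : SSet.{u}) (n : ℕ) :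
    (exStep n).app X ≫ ExInf.ι X (n + 1) = ExInf.ι X n := by
  rw [← exSequence_map_succ]
  exact colimit.w (exSequence X) _

theorem toExIter_ι (X : SSet.{u}) (n : ℕ) :
    toExIter n X ≫ ExInf.ι X n = ExInf.ι X 0 := by
  rw [← exSequence_map_zero]
  exact colimit.w (exSequence X) _

/-- The natural map `X ⟶ Ex^∞ X`. -/
noncomputable def toExInf (X : SSet.{u}) : X ⟶ ExInf X := ExInf.ι X 0

theorem toExInf_naturality (p : X ⟶ Y) : toExInf X ≫ ExInf.map p = p ≫ toExInf Y :=
  ι_colimMap (exSequenceMap p) 0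

/-- The sequence of iterated extensions exhibits `X ⟶ Ex^∞ X` as a transfinite composition. -/
theorem mem_of_exStep (P : MorphismProperty SSet.{u})
    [MorphismProperty.IsStableUnderTransfiniteComposition.{0} P] (X : SSet.{u})
    (h : ∀ n, P ((exStep n).app X)) (n : ℕ) : P (ExInf.ι X n) := by
  let c : P.TransfiniteCompositionOfShape ℕ (toExInf X) :=
    { F := exSequence X
      isoBot := Iso.refl _
      incl := (colimit.cocone (exSequence X)).ι
      isColimit := colimit.isColimit _
      fac := Category.id_comp _
      map_mem := fun j _ => by
        have : P ((exSequence X).map (homOfLE j.le_succ)) := by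
          rw [exSequence_map_succ]
          exact h j
        exact this }
  exact c.mem_incl_app n

instance mono_ExInf_ι (X : SSet.{u}) (n : ℕ) : Mono (ExInf.ι X n) :=
  mem_of_exStep (MorphismProperty.monomorphisms _) X (fun _ => .infer_property _) n

instance mono_toExInf (X : SSet.{u}) : Mono (toExInf X) := mono_ExInf_ι X 0

theorem anodyneExtensions_toExInf (X : SSet.{u}) : anodyneExtensions (toExInf X) := by
  rw [← llp_kanFibrations]
  refine mem_of_exStep _ X (fun n => ?_) 0
  rw [llp_kanFibrations]
  exact anodyneExtensions_exStep n X

/-- A horn in `Ex^∞ X` comes from a finite stage, and has a filler two stages later by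
Kan's lemma. -/
theorem kanComplex_ExInf (X : SSet.{u}) : KanComplex (ExInf X) := by
  rw [kanComplex_iff]
  intro n k
  refine ⟨fun {f g} sq => ?_⟩
  obtain ⟨j, f, rfl⟩ := exists_factorization (F := exSequence X) f
  let f' : (Λ[n + 1, k] : SSet.{u}) ⟶ Ex.obj ((exIter j).obj X) := f ≫ (exStep j).app X
  obtain ⟨l, hl⟩ := exists_horn_filler_toEx f'
  refine ⟨⟨l ≫ ExInf.ι X (j + 2), ?_, by subsingleton⟩⟩
  exact (Category.assoc _ _ _).symm.trans ((congrArg (fun t => t ≫ ExInf.ι X (j + 2)) hl).trans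
    ((Category.assoc _ _ _).trans ((congrArg (fun t => f' ≫ t) (exStep_ι X (j + 1))).trans
      ((Category.assoc _ _ _).trans (congrArg (fun t => f ≫ t) (exStep_ι X j))))))

theorem kanFibrations_ExInf_map {p : X ⟶ Y} (hp : kanFibrations p) :
    kanFibrations (ExInf.map p) :=
  kanFibrations_colimMap _ fun n => kanFibrations_exIter_map hp n

theorem weakEqs_toExInf (X : SSet.{u}) : weakEqs (toExInf X) :=
  weakEqs_of_anodyne (anodyneExtensions_toExInf X)

/-- The functor `Ex^∞` replaces a Kan fibration by an equivalent one between Kan complexes. -/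
theorem rlp_ExInf_map {p : X ⟶ Y} (hp : kanFibrations p) (hw : weakEqs p) :
    (MorphismProperty.monomorphisms SSet.{u}).rlp (ExInf.map p) := by
  refine rlp_of_weakEqs_of_kanComplex (kanFibrations_ExInf_map hp) (kanComplex_ExInf X)
    (kanComplex_ExInf Y) ?_
  refine weakEqs.of_precomp _ _ (weakEqs_toExInf X) ?_
  rw [toExInf_naturality]
  exact weakEqs.comp_mem _ _ hw (weakEqs_toExInf Y)

/-- A Kan fibration which is a weak equivalence has the right lifting property with respect to all
monomorphisms. It is enough to extend maps from `∂Δ[m]` to a fiber, which is a Kan complex. After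
applying `Ex^∞`, such an extension exists in a fiber of `ExInf.map p`, hence at a finite stage,
where it is an extension in the iterated extension of the fiber since `Ex` preserves pullbacks. It
is brought back to the fiber by a retraction. -/
theorem rlp_of_weakEqs {p : X ⟶ Y} (hp : kanFibrations p) (hw : weakEqs p) :
    (MorphismProperty.monomorphisms SSet.{u}).rlp p := by
  refine rlp_of_fibers hp fun y m f hf => ?_
  -- the fiber of `p` over `y`
  let v : ⊤_ SSet.{u} ⟶ Y := SSet.const y
  have hF : KanComplex (pullback p v) := by
    rw [kanComplex_iff, Subsingleton.elim (terminal.from _) (pullback.snd p v),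
      kanFibrations_eq_rlp]
    refine MorphismProperty.pullback_snd _ _ ?_
    rwa [← kanFibrations_eq_rlp]
  let f' : (∂Δ[m] : SSet.{u}) ⟶ pullback p v := pullback.lift f (terminal.from _) hf
  have hf₁ : f' ≫ pullback.fst p v = f := pullback.lift_fst _ _ _
  obtain ⟨L, hL, hL'⟩ := exists_lift_of_rlp (rlp_ExInf_map hp hw) ∂Δ[m].ι (f := f ≫ toExInf X)
    (g := SSet.const y ≫ toExInf Y) (by
      rw [Category.assoc, toExInf_naturality, ← Category.assoc, hf, ← Category.assoc, comp_const])
  obtain ⟨n, L, rfl⟩ : ∃ (n : ℕ) (L' : Δ[m] ⟶ (exIter n).obj X), L' ≫ ExInf.ι X n = L :=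
    exists_factorization (F := exSequence X) L
  have hfL : ∂Δ[m].ι ≫ L = f ≫ toExIter n X := by
    rw [← cancel_mono (ExInf.ι X n), Category.assoc, hL, Category.assoc, toExIter_ι]
    rfl
  have hLp : L ≫ (exIter n).map p = SSet.const y ≫ toExIter n Y := by
    rw [← cancel_mono (ExInf.ι Y n), Category.assoc, Category.assoc, toExIter_ι]
    refine Eq.trans ?_ hL'
    rw [Category.assoc]
    exact congrArg (fun t => L ≫ t) (ι_colimMap (exSequenceMap p) n).symm
  -- the iterated extension of the fiber is the fiber of the iterated extensions
  have sq := (IsPullback.of_hasPullback p v).map (exIter n)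
  obtain ⟨M, hM, hM'⟩ := sq.exists_lift L (terminal.from _ ≫ toExIter n _) (by
    rw [hLp, Category.assoc]
    refine Eq.trans ?_ (congrArg (fun t => terminal.from (Δ[m] : SSet.{u}) ≫ t)
      (toExIter_naturality n v).symm)
    rfl)
  -- the fiber is a Kan complex, hence a retract of its iterated extension
  obtain ⟨r, hr⟩ := exists_extension_of_anodyne (anodyneExtensions_toExIter n _) hF (𝟙 _)
  have hf' : ∂Δ[m].ι ≫ M = f' ≫ toExIter n (pullback p v) := by
    have h₁ : toExIter n (pullback p v) ≫ (exIter n).map (pullback.fst p v) =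
        pullback.fst p v ≫ toExIter n X := toExIter_naturality n _
    have h₂ : toExIter n (pullback p v) ≫ (exIter n).map (pullback.snd p v) =
        pullback.snd p v ≫ toExIter n _ := toExIter_naturality n _
    refine sq.hom_ext ?_ ?_
    · rw [Category.assoc, hM, hfL, Category.assoc, h₁, reassoc_of% hf₁]
    · rw [Category.assoc, hM', Category.assoc, h₂, ← Category.assoc, ← Category.assoc]
      congr 1
      subsingleton
  refine ⟨M ≫ r ≫ pullback.fst p v, ?_, ?_⟩
  · rw [← Category.assoc, hf', Category.assoc]
    rw [reassoc_of% hr]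
    exact hf₁
  · rw [Category.assoc, Category.assoc, pullback.condition]
    rfl

/-! ### The weak factorization systems -/

section

open modelCategoryQuillen

theorem kanFibrations_inf_weakEqs : kanFibrations.{u} ⊓ weakEqs = I.rlp := by
  rw [← rlp_monomorphisms]
  exact le_antisymm (fun _ _ _ hp => rlp_of_weakEqs hp.1 hp.2)
    fun _ _ _ hp => ⟨kanFibrations_of_rlp hp, weakEqs_of_rlp hp⟩

theorem cofs_eq : cofs.{u} = I.rlp.llp := by rw [cofs, kanFibrations_inf_weakEqs]

/-- Anodyne extensions are monomorphisms, since their source embeds into a Kan complex. -/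
theorem mono_of_anodyne {i : A ⟶ B} (hi : anodyneExtensions i) : Mono i := by
  obtain ⟨l, hl⟩ := exists_extension_of_anodyne hi (kanComplex_ExInf A) (toExInf A)
  exact mono_of_mono_fac hl

section

attribute [local instance] Cardinal.fact_isRegular_aleph0 Cardinal.orderBotAleph0OrdToType

instance isSmall_I : MorphismProperty.IsSmall.{u} I.{u} := MorphismProperty.isSmall_ofHoms ..

instance isCardinalForSmallObjectArgument_I :
    MorphismProperty.IsCardinalForSmallObjectArgument I.{u} Cardinal.aleph0.{u} where
  preservesColimit {A B X Y} i hi f hf := by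
    have : IsFinitelyPresentable.{u} A := by
      obtain ⟨n⟩ := hi
      infer_instance
    infer_instance

instance hasSmallObjectArgument_I : MorphismProperty.HasSmallObjectArgument.{u} I.{u} :=
  ⟨.aleph0, inferInstance, inferInstance, inferInstance⟩

end

instance hasFunctorialFactorization_cofs :
    cofs.{u}.HasFunctorialFactorization (kanFibrations ⊓ weakEqs) := by
  rw [cofs_eq, kanFibrations_inf_weakEqs]
  infer_instance

instance hasFunctorialFactorization_anodyneExtensions :
    anodyneExtensions.{u}.HasFunctorialFactorization kanFibrations := by
  rw [anodyneExtensions_eq_llp_rlp, kanFibrations_eq_rlp]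
  infer_instance

/-- A cofibration that is a weak equivalence is a retract of the anodyne extension which appears
in its factorization. -/
theorem cofs_inf_weakEqs : cofs.{u} ⊓ weakEqs = anodyneExtensions := by
  refine le_antisymm (fun A B i hi => ?_) fun A B i hi => ⟨?_, ?_⟩
  · let h := MorphismProperty.factorizationData anodyneExtensions kanFibrations i
    have hw : weakEqs h.p := by
      have := mono_of_anodyne h.hi
      refine weakEqs.of_precomp _ _ (weakEqs_of_anodyne h.hi) ?_
      rw [h.fac]
      exact hi.2
    have := hi.1 h.p ⟨h.hp, hw⟩
    exact MorphismProperty.of_retract (RetractArrow.ofLeftLiftingProperty h.fac) h.hi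
  · exact fun _ _ p hp => hasLiftingProperty_of_anodyne hi hp.1
  · have := mono_of_anodyne hi
    exact weakEqs_of_anodyne hi

instance hasFunctorialFactorization_cofs_inf_weakEqs :
    (cofs.{u} ⊓ weakEqs).HasFunctorialFactorization kanFibrations := by
  rw [cofs_inf_weakEqs]
  infer_instance

end

/-- The Kan–Quillen model structure. -/
@[reducible]
noncomputable def modelCategory : HomotopicalAlgebra.ModelCategory SSet.{u} where
  categoryWithFibrations := ⟨kanFibrations⟩
  categoryWithCofibrations := ⟨cofs⟩
  categoryWithWeakEquivalences := ⟨weakEqs⟩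
  cm2 := inferInstanceAs weakEqs.HasTwoOutOfThreeProperty
  cm3a := inferInstanceAs weakEqs.IsStableUnderRetracts
  cm3b := by
    change kanFibrations.IsStableUnderRetracts
    rw [kanFibrations_eq_rlp]
    infer_instance
  cm3c := by
    change cofs.IsStableUnderRetracts
    rw [cofs_eq]
    infer_instance
  cm4a i p hi hw hp := by
    have h : (cofs ⊓ weakEqs) i := ⟨hi.mem, hw.mem⟩
    rw [cofs_inf_weakEqs] at h
    exact hasLiftingProperty_of_anodyne h hp.mem
  cm4b i p hi hp hw := hi.mem p ⟨hp.mem, hw.mem⟩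
  cm5a := inferInstanceAs ((cofs ⊓ weakEqs).HasFactorization kanFibrations)
  cm5b := inferInstanceAs (cofs.HasFactorization (kanFibrations ⊓ weakEqs))

end KanSSet

theorem theorem1p1 :
    ∃ _M : HomotopicalAlgebra.ModelCategory SSet.{u},
      HomotopicalAlgebra.fibrations SSet.{u} = KanSSet.kanFibrations ∧
      HomotopicalAlgebra.weakEquivalences SSet.{u} = KanSSet.weakEqs ∧
      HomotopicalAlgebra.cofibrations SSet.{u} = KanSSet.cofs ∧
      Limits.HasLimits SSet.{u} ∧
      Limits.HasColimits SSet.{u} ∧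
      MorphismProperty.HasFunctorialFactorization
        (HomotopicalAlgebra.cofibrations SSet.{u})
        (HomotopicalAlgebra.trivialFibrations SSet.{u}) ∧
      MorphismProperty.HasFunctorialFactorization
        (HomotopicalAlgebra.trivialCofibrations SSet.{u})
        (HomotopicalAlgebra.fibrations SSet.{u}) :=
  ⟨KanSSet.modelCategory, rfl, rfl, rfl, inferInstance, inferInstance,
    KanSSet.hasFunctorialFactorization_cofs,
    KanSSet.hasFunctorialFactorization_cofs_inf_weakEqs⟩
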